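/- \textbf{Setting.} Let $d\ge 1$, $N\ge 2$ be integers and $D,B,P,\sigma>0$; put $\mathrm{SNR}=P/\sigma^2$. Let $\mathbb X$ be the family of nonempty closed convex sets $\mathcal X\subset\mathbb R^d$ of diameter at most $D$. For $\mathcal X\in\mathbb X$ let $\mathcal O$ be the set of pairs $(f,O)$ of a convex function $f:\mathcal X\to\mathbb R$ and a stochastic oracle $O$ whose answer $\hat g$ to a query $x\in\mathcal X$ has a law depending only on $x$, with $\mathbb E\,\hat g\in\partial f(x)$ and $\mathbb E\|\hat g\|^2\le B^2$. A $(d,\ell,P)$-code is an encoder $\varphi:\mathbb R^d\times\mathcal U\to\mathbb R^\ell$ with $\mathbb E\|\varphi(\hat g,U)\|^2\le \ell P$ for every random $\hat g$ with $\mathbb E\|\hat g\|^2\le B^2$ that is independent of the public randomness $U$. An over-the-air protocol with $T$ queries chooses in iteration $t=1,\dots,T$ a point $x_t\in\mathcal X$ as a function of the earlier channel outputs and public randomness, obtains $\hat g_t$ from the oracle and observes $Y_t=\varphi(\hat g_t,U_t)+Z_t$, where $U_t$ is a fresh copy of the public randomness, known to the algorithm after the query, and $Z_t\sim\mathcal N(0,\sigma^2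 I_\ell)$ is fresh noise; finally it outputs a point $\hat x\in\mathcal X$ that is a function of $(U_t,Y_t)_{t\le T}$. Its error is $\mathbb E f(\hat x)-\min_{\mathcal X}f$. Let $$\mathcal E^*(N)=\sup_{\mathcal X\in\mathbb X}\ \inf_{\ell T\le N}\ \sup_{(f,O)\in\mathcal O}\bigl(\mathbb E f(\hat x)-\min_{\mathcal X} f\bigr),$$ the infimum being over all protocols with at most $N$ channel uses. \textbf{Theorem.} Let $\ln^* a$ be the least number of applications of $\ln$ to $a$ that gives a value less than $1$, and let $r=\log_2\bigl(\sqrt{4\,\mathrm{SNR}/\ln N}+1\bigr)$. If $\ln^*(d/3)\le 7$ and $r\ge 6$, then $$\mathcal E^*(N)\le \frac{2DB}{\sqrt N}\sqrt{\frac{d}{\min\{d,\,r/48\}}}.$$ Moreover, there are a choice of the parameters $b,k,\zeta$ of the following gain-shape scheme, with the shape quantized to at most $r$ bits, a number $1\le T\le N/2$ of queries and a step size $\eta>0$ such that, for every $\mathcal X\in\mathbb X$ and every starting point $x_1\in\mathcal X$, projected subgradient descent $x_{t+1}=\Gamma_{\mathcal X}(x_t-\eta\,\psi(U_t,Y_t))$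 (with $\Gamma_{\mathcal X}$ the Euclidean projection) with output $\frac1T\sum_{t=1}^T x_t$ has worst-case error $\sup_{(f,O)\in\mathcal O}$ at most the same bound. \textbf{The scheme} uses $\ell=2$ channel uses per query. Let $n$ be the least power of two with $n\ge d$ (so $n=d$ if $d$ is a power of two; otherwise vectors are padded by zeros to dimension $n$). The gain $\|\hat g\|$ is sent as $(\sqrt P/B)\|\hat g\|$ and rescaled by $B/\sqrt P$ on reception. The shape $\hat g/\|\hat g\|$ (read as $0$ if $\hat g=0$) is multiplied by $R=n^{-1/2}H\Delta$, with $H$ the $n\times n$ Walsh--Hadamard matrix and $\Delta$ a diagonal matrix of public independent uniform signs; a public uniformly random set of $b$ coordinates ($1\le b\le n$) is kept; for each of them the smallest of the intervals $[-M_i,M_i]$, $1\le i\le h$, containing it is determined, where $M_i^2=\frac3n e^{*(i-1)}$, $e^{*0}=1$, $e^{*i}=e^{e^{*(i-1)}}$ and $\log_2 h=\lceil\log_2(1+\ln^*(d/3))\rceil$, and the coordinate is randomly rounded without bias, independently over the coordinates, to one of the two neighbouring points among $k$ equally spaced levels of that interval ($k\ge2$ a power of two). The resulting $\rho=b\log_2(hk)\le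 r$ bits are mapped by a bijection $\zeta$ to the ASK constellation $\{-\sqrt P+2(i-1)\sqrt P/(2^{\rho}-1): 1\le i\le 2^{\rho}\}$ and sent in one channel use. The receiver applies minimum-distance decoding and $\zeta^{-1}$, sets the unsampled coordinates to $0$, multiplies by $(n/b)R^{-1}$ and drops the padded coordinates; $\psi$ is the product of the decoded gain and the decoded shape. -/

import Mathlib

open MeasureTheory ProbabilityTheory
open scoped ENNReal NNReal

namespace OverTheAir

noncomputable section

/-- The space `ℝ^d` with its Euclidean norm. -/
abbrev E (d : ℕ) : Type := EuclideanSpace ℝ (Fin d)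

/-! ### Domains, functions and oracles -/

/-- Admissible domains: nonempty closed convex sets of diameter at most `D`. -/
structure IsAdmissible {d : ℕ} (D : ℝ) (X : Set (E d)) : Prop where
  nonempty : X.Nonempty
  isClosed : IsClosed X
  convex : Convex ℝ X
  diam_le : ∀ x ∈ X, ∀ y ∈ X, ‖x - y‖ ≤ D

/-- The set of subgradients at `x` of a function `f` on `X`. -/
def subdifferential {d : ℕ} (X : Set (E d)) (f : E d → ℝ) (x : E d) : Set (E d) :=
  {v | ∀ y ∈ X, f x + inner ℝ v (y - x) ≤ f y}

/-- `f` is convex on `X` and `O x`, the law of the oracle's answer to the query `x`, has its mean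
in `∂f(x)` and second moment at most `B²`, for every `x ∈ X`. -/
structure IsOracle {d : ℕ} (X : Set (E d)) (B : ℝ) (f : E d → ℝ) (O : Kernel (E d) (E d)) :
    Prop where
  markov : IsMarkovKernel O
  convexOn : ConvexOn ℝ X f
  unbiased : ∀ x ∈ X, ∫ g, g ∂(O x) ∈ subdifferential X f x
  meanSquare : ∀ x ∈ X, ∫⁻ g, ‖g‖ₑ ^ 2 ∂(O x) ≤ ENNReal.ofReal (B ^ 2)

/-! ### Codes, channel and protocols -/

/-- A `(d, ℓ, P)`-code using public randomness with law `ν` on `𝒰`. The average power constraint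
is imposed for every law `p` of the subgradient estimate with second moment at most `B²`,
the estimate being independent of the public randomness. -/
structure Code (d ℓ : ℕ) (P B : ℝ) (𝒰 : Type) [MeasurableSpace 𝒰] (ν : Measure 𝒰) where
  enc : 𝒰 → E d → (Fin ℓ → ℝ)
  measurable_enc : Measurable fun q : 𝒰 × E d => enc q.1 q.2
  power : ∀ p : Measure (E d), IsProbabilityMeasure p →
    ∫⁻ g, ‖g‖ₑ ^ 2 ∂p ≤ ENNReal.ofReal (B ^ 2) →
    ∫⁻ q, ENNReal.ofReal (∑ i, enc q.1 q.2 i ^ 2) ∂(ν.prod p) ≤ ENNReal.ofReal (ℓ * P)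

/-- An over-the-air optimization protocol with `T` oracle queries on the domain `X`. In each
iteration a fresh independent copy of the public randomness is used. What the algorithm knows
after `t` iterations is the list of pairs (public randomness, channel output) of these iterations.
The values of `query t` for `t ≥ T` are irrelevant. -/
structure Protocol {d : ℕ} (X : Set (E d)) (ℓ T : ℕ) (P B : ℝ)
    (𝒰 : Type) [MeasurableSpace 𝒰] (ν : Measure 𝒰) where
  code : Code d ℓ P B 𝒰 ν
  query : (t : ℕ) → (Fin t → 𝒰 × (Fin ℓ → ℝ)) → E d
  measurable_query : ∀ t, Measurable (query t)
  query_mem : ∀ t h, query t h ∈ X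
  output : (Fin T → 𝒰 × (Fin ℓ → ℝ)) → E d
  measurable_output : Measurable output
  output_mem : ∀ h, output h ∈ X

/-- The law of `ℓ` i.i.d. centred Gaussian variables of variance `σ²`. -/
def noise (ℓ : ℕ) (σ : ℝ) : Measure (Fin ℓ → ℝ) :=
  Measure.pi fun _ => gaussianReal 0 (σ ^ 2).toNNReal

namespace Protocol

variable {d : ℕ} {X : Set (E d)} {ℓ T : ℕ} {P B : ℝ}
  {𝒰 : Type} [MeasurableSpace 𝒰] {ν : Measure 𝒰}

/-- Conditional law of (public randomness, channel output) in iteration `t` given the history: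
the public randomness `u`, the oracle's answer `g` at the queried point and the noise `z` are
independent, and the channel output is `enc u g + z`. -/
def step (π : Protocol X ℓ T P B 𝒰 ν) (σ : ℝ) (O : Kernel (E d) (E d)) (t : ℕ) :
    Kernel (Fin t → 𝒰 × (Fin ℓ → ℝ)) (𝒰 × (Fin ℓ → ℝ)) :=
  (Kernel.const _ ν ×ₖ (O.comap (π.query t) (π.measurable_query t) ×ₖ
    Kernel.const _ (noise ℓ σ))).map
    fun w : 𝒰 × E d × (Fin ℓ → ℝ) => (w.1, π.code.enc w.1 w.2.1 + w.2.2)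

/-- Joint law of the history of the first `t` iterations. -/
def law (π : Protocol X ℓ T P B 𝒰 ν) (σ : ℝ) (O : Kernel (E d) (E d)) :
    (t : ℕ) → Measure (Fin t → 𝒰 × (Fin ℓ → ℝ))
  | 0 => Measure.dirac Fin.elim0
  | t + 1 => (π.law σ O t ⊗ₘ π.step σ O t).map
      fun w => Fin.snoc (α := fun _ => 𝒰 × (Fin ℓ → ℝ)) w.1 w.2

/-- The convergence error `𝔼 f(x_T) - min_X f`. The integrand is nonnegative. -/
def error (π : Protocol X ℓ T P B 𝒰 ν) (σ : ℝ) (f : E d → ℝ) (O : Kernel (E d) (E d)) : ℝ≥0∞ :=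
  ∫⁻ h, ENNReal.ofReal (f (π.output h) - sInf (f '' X)) ∂(π.law σ O T)

/-- Worst-case convergence error over all pairs of a function and an oracle. -/
def worstError (π : Protocol X ℓ T P B 𝒰 ν) (σ : ℝ) : ℝ≥0∞ :=
  ⨆ (f : E d → ℝ) (O : Kernel (E d) (E d)) (_ : IsOracle X B f O), π.error σ f O

end Protocol

/-- `ℰ*(N, X)`: least worst-case error of protocols with at most `N` channel uses. -/
def minError {d : ℕ} (X : Set (E d)) (P B σ : ℝ) (N : ℕ) : ℝ≥0∞ :=
  ⨅ (𝒰 : Type) (_ : MeasurableSpace 𝒰) (ν : Measure 𝒰) (_ : IsProbabilityMeasure ν)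
    (ℓ : ℕ) (T : ℕ) (_ : 0 < ℓ) (_ : ℓ * T ≤ N) (π : Protocol X ℓ T P B 𝒰 ν), π.worstError σ

/-- `ℰ*(N)`: supremum of `ℰ*(N, X)` over all admissible domains. -/
def minmaxError (d : ℕ) (D B P σ : ℝ) (N : ℕ) : ℝ≥0∞ :=
  ⨆ (X : Set (E d)) (_ : IsAdmissible D X), minError X P B σ N

/-! ### Projected subgradient descent -/

/-- `p` is the projection of `y` to `X`. -/
def IsProj {d : ℕ} (X : Set (E d)) (y p : E d) : Prop :=
  p ∈ X ∧ ∀ x ∈ X, ‖y - p‖ ≤ ‖y - x‖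

/-- The algorithm of `π` is projected subgradient descent with starting point `x₀`, step size `η`
and decoder `ψ`; its output is the average of the `T` queried points. -/
structure Protocol.IsPSGD {d : ℕ} {X : Set (E d)} {ℓ T : ℕ} {P B : ℝ}
    {𝒰 : Type} [MeasurableSpace 𝒰] {ν : Measure 𝒰} (π : Protocol X ℓ T P B 𝒰 ν)
    (ψ : 𝒰 → (Fin ℓ → ℝ) → E d) (η : ℝ) (x₀ : E d) : Prop where
  init : ∀ h, π.query 0 h = x₀
  step : ∀ (t : ℕ) (h : Fin (t + 1) → 𝒰 × (Fin ℓ → ℝ)),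
    IsProj X (π.query t (fun s => h s.castSucc) - η • ψ (h (Fin.last t)).1 (h (Fin.last t)).2)
      (π.query (t + 1) h)
  average : ∀ h : Fin T → 𝒰 × (Fin ℓ → ℝ),
    π.output h = (T : ℝ)⁻¹ • ∑ t : Fin T, π.query t (fun s => h (s.castLE t.isLt.le))

/-! ### Subsampled RATQ -/

/-- `ln* a`: the least number of applications of `ln` to `a` giving a value less than `1`. -/
def lnStar (a : ℝ) : ℕ := sInf {n : ℕ | Real.log^[n] a < 1}

/-- Tetra-iteration `e^{*i}`, with `e^{*0} = 1`. -/
def tetra : ℕ → ℝ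
  | 0 => 1
  | i + 1 => Real.exp (tetra i)

/-- The least power of two that is at least `d`; equal to `d` if `d` is a power of two. -/
def padDim (d : ℕ) : ℕ := 2 ^ Nat.clog 2 d

/-- Padding a vector by zeros to dimension `n` (used with `d ≤ n`). -/
def pad {d : ℕ} (n : ℕ) (x : E d) : Fin n → ℝ :=
  fun i => if h : (i : ℕ) < d then x ⟨i, h⟩ else 0

/-- Dropping the padded coordinates (used with `d ≤ n`). -/
def unpad {n : ℕ} (d : ℕ) (y : Fin n → ℝ) : E d :=
  WithLp.toLp 2 fun i => if h : (i : ℕ) < n then y ⟨i, h⟩ else 0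

/-- Walsh-Hadamard matrix (for `n` a power of two): the `(i, j)` entry is `(-1)` to the number of
common binary ones of `i` and `j`. -/
def walshHadamard (n : ℕ) : Matrix (Fin n) (Fin n) ℝ :=
  fun i j => ∏ m ∈ Finset.range n, if (i : ℕ).testBit m ∧ (j : ℕ).testBit m then -1 else 1

/-- The rotation `R = n^{-1/2} H D`, where `D` is the diagonal matrix with the signs coded by
`s`. -/
def rotation {n : ℕ} (s : Fin n → Bool) : Matrix (Fin n) (Fin n) ℝ :=
  (√(n : ℝ))⁻¹ • (walshHadamard n * Matrix.diagonal fun i => if s i then (1 : ℝ) else -1)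

/-- Subsets of `{0, …, n-1}` with `b` elements. -/
def Subsample (n b : ℕ) : Type := {S : Finset (Fin n) // S.card = b}

instance (n b : ℕ) : MeasurableSpace (Subsample n b) := ⊤

/-- The endpoints `M_1, M_2, …` (indexed from `0`): `M_i² = (3/n) e^{*(i-1)}`. -/
def endpoint (n i : ℕ) : ℝ := √(3 / n * tetra i)

/-- Number of bits for the interval: `log h_s = ⌈log (1 + ln*(d/3))⌉`. -/
def hBits (d : ℕ) : ℕ := Nat.clog 2 (1 + lnStar ((d : ℝ) / 3))

/-- The least `j` with `|x| ≤ M_j`, among `2 ^ e` intervals (the last one on overflow). -/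
def intervalIndex (n e : ℕ) (x : ℝ) : Fin (2 ^ e) :=
  ⟨min (sInf {j : ℕ | |x| ≤ endpoint n j}) (2 ^ e - 1),
    lt_of_le_of_lt (min_le_right _ _) (Nat.sub_lt (by positivity) one_pos)⟩

/-- The `l`-th (from `0`) of the `k` equally spaced levels in `[-M, M]`. -/
def level (M : ℝ) (k l : ℕ) : ℝ := -M + l * (2 * M / ((k : ℝ) - 1))

/-- Left end `l*` of a sub-interval `[level l*, level (l*+1)]`, `l* ≤ k - 2`, containing `x`. -/
def leftLevel (M : ℝ) (k : ℕ) (x : ℝ) : ℕ :=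
  min ⌊(x + M) / (2 * M / ((k : ℝ) - 1))⌋₊ (k - 2)

/-- Stochastic uniform quantization with `2 ^ κ ≥ 2` levels: for `v` uniform on `[0,1]` the right
end of the sub-interval `[level l*, level (l*+1)]` containing `x` is chosen with probability
`(x - level l*) / (level (l*+1) - level l*)`, the left end otherwise. -/
def levelIndex (M : ℝ) (κ : ℕ) (hκ : 1 ≤ κ) (v : unitInterval) (x : ℝ) : Fin (2 ^ κ) :=
  if (v : ℝ) < (x - level M (2 ^ κ) (leftLevel M (2 ^ κ) x)) /
      (level M (2 ^ κ) (leftLevel M (2 ^ κ) x + 1) - level M (2 ^ κ) (leftLevel M (2 ^ κ) x))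
  then ⟨leftLevel M (2 ^ κ) x + 1, by
    have h1 : leftLevel M (2 ^ κ) x ≤ 2 ^ κ - 2 := min_le_right _ _
    have h2 : 2 ^ 1 ≤ 2 ^ κ := Nat.pow_le_pow_right (by norm_num) hκ
    omega⟩
  else ⟨leftLevel M (2 ^ κ) x, by
    have h1 : leftLevel M (2 ^ κ) x ≤ 2 ^ κ - 2 := min_le_right _ _
    have h2 : 2 ^ 1 ≤ 2 ^ κ := Nat.pow_le_pow_right (by norm_num) hκ
    omega⟩

/-! ### The gain-shape scheme -/

/-- The `p`-th (from `0`) of the `2 ^ ρ` points of the ASK constellation in `[-√P, √P]`. -/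
def askPoint (P : ℝ) (ρ : ℕ) (p : Fin (2 ^ ρ)) : ℝ :=
  -√P + (p : ℕ) * (2 * √P) / ((2 : ℝ) ^ ρ - 1)

/-- Free choices in the gain-shape scheme: the number `b` of subsampled coordinates (`μ d` with
`μ` the sampling rate), the number `2 ^ κ` of uniform quantization levels, the one-to-one
correspondence `ζ` between quantizer outputs and points of the ASK constellation, and the
tie-breaking rule of the minimum-distance decoder `detect`. -/
structure GainShapeScheme (d : ℕ) (P : ℝ) where
  b : ℕ
  one_le_b : 1 ≤ b
  b_le : b ≤ padDim d
  κ : ℕ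
  one_le_κ : 1 ≤ κ
  ζ : (Fin b → Fin (2 ^ hBits d) × Fin (2 ^ κ)) ≃ Fin (2 ^ (b * (hBits d + κ)))
  detect : ℝ → Fin (2 ^ (b * (hBits d + κ)))
  detect_min : ∀ y p, |y - askPoint P (b * (hBits d + κ)) (detect y)| ≤
    |y - askPoint P (b * (hBits d + κ)) p|

namespace GainShapeScheme

variable {d : ℕ} {P : ℝ} (S : GainShapeScheme d P)

/-- The number of bits to which the shape is quantized. -/
def bits : ℕ := S.b * (hBits d + S.κ)

/-- Random signs of the rotation, the subsampled set, and the randomness of the quantizers of the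
subsampled coordinates. -/
abbrev Rand : Type :=
  (Fin (padDim d) → Bool) × Subsample (padDim d) S.b × (Fin S.b → unitInterval)

/-- The three components are independent and uniformly distributed. -/
def randLaw : Measure S.Rand :=
  (uniformOn Set.univ).prod ((uniformOn Set.univ).prod volume)

/-- The coordinates in the subsampled set, in increasing order. -/
def coord (u : S.Rand) (a : Fin S.b) : Fin (padDim d) :=
  u.2.1.1.orderEmbOfFin u.2.1.2 a

/-- Output of the quantizer for the shape `x`: index of the interval and index of the level, for
each subsampled coordinate of the rotated vector. -/
def quantize (u : S.Rand) (x : E d) (a : Fin S.b) : Fin (2 ^ hBits d) × Fin (2 ^ S.κ) :=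
  let y : ℝ := (rotation u.1).mulVec (pad (padDim d) x) (S.coord u a)
  let j := intervalIndex (padDim d) (hBits d) y
  (j, levelIndex (endpoint (padDim d) j) S.κ S.one_le_κ (u.2.2 a) y)

/-- Two channel uses: the quantized shape by ASK, then the scaled gain. -/
def enc (B : ℝ) (u : S.Rand) (g : E d) : Fin 2 → ℝ :=
  ![askPoint P S.bits (S.ζ (S.quantize u (‖g‖⁻¹ • g))), √P / B * ‖g‖]

/-- The vector in `ℝ^n` described by a quantizer output; unsampled coordinates are `0`. -/
def dequantize (u : S.Rand) (q : Fin S.b → Fin (2 ^ hBits d) × Fin (2 ^ S.κ)) :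
    Fin (padDim d) → ℝ :=
  fun i => ∑ a, if S.coord u a = i then
    level (endpoint (padDim d) (q a).1) (2 ^ S.κ) (q a).2 else 0

/-- Shape decoder: minimum-distance decoding, inverse of `ζ`, multiplication by `1/μ` and by
`R⁻¹`. -/
def shapeDec (u : S.Rand) (y : ℝ) : E d :=
  unpad d (((padDim d : ℝ) / S.b) •
    ((rotation u.1)⁻¹).mulVec (S.dequantize u (S.ζ.symm (S.detect y))))

/-- Decoder: product of the rescaled gain and the decoded shape. -/
def dec (B : ℝ) (u : S.Rand) (y : Fin 2 → ℝ) : E d :=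
  (B / √P * y 1) • S.shapeDec u (y 0)

end GainShapeScheme

end

end OverTheAir

namespace OverTheAir

noncomputable section

/-! ### Tetration, the iterated logarithm and the choice of intervals -/

/-! The scheme feeds projected subgradient descent with an estimate that is unbiased unless ASK
detection fails. So the error depends on two numbers: the second-moment factor `A` of the decoded
shape and the outage probability `p`.

The wrong decodings are never analysed. The next iterate and the minimizer both lie in `X`, so their
squared distance is at most `D²` whatever was decoded. Comparing with the error-free decoder on
every outcome and paying `D² p` for the outage gives the drift inequality `𝔼‖x⁺ - x*‖² ≤ ‖x - x*‖² -
2η⟨𝔼ĝ, x - x*⟩ + η²a + D²p` with `a = A B² (1 + 1/SNR)` (`integral_drift_le`). The error-free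
estimate is unbiased because every rounding is, because `n/b` undoes the sampling, and because `R`
is orthogonal (`integral_inner_quantizedShape`); the noise on the gain is centred and contributes
only the `1/SNR`. Telescoping and Jensen's inequality turn the drift into the error bound `(D²(1 +
Tp) + Tη²a) / (2ηT)` (`error_le_of_drift`).

The factor `A` is `n/b` times a constant (`integral_norm_quantizedShape_sq_le`), because the mean
squared endpoint of the chosen interval is at most `6.3/n`: passing the `j`-th endpoint raises the
squared endpoint by at most `(3/n) exp (e^{*j})`, but a rotated coordinate passes it with
probability at most `2 exp (-(3/2) e^{*j})` (`sum_tetra_intervalIndex_le`). The hypothesis on `ln*`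
keeps the interval index within three bits.

Using at most `r - 2` bits makes `p ≤ 2/N²` (`outage_le`), so outages over `T ≤ N/2` queries cost
only a factor `1 + 1/N`. `exists_params` distributes the bits so that `A`, with all correction
factors, is at most `2λ`, where `λ = d / min{d, r/48}`. If `N ≤ 4λ`, the target is at least `DB`,
which any protocol achieves. -/

theorem one_le_tetra (i : ℕ) : 1 ≤ tetra i := by
  cases i with
  | zero => exact le_rfl
  | succ i =>
    have h : 0 ≤ tetra i := by
      induction i with
      | zero => exact zero_le_one
      | succ i _ => exact (Real.exp_pos _).le
    exact Real.one_le_exp h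

theorem tetra_le_succ (i : ℕ) : tetra i ≤ tetra (i + 1) := by
  have := Real.add_one_le_exp (tetra i)
  simp only [tetra]
  linarith

theorem tetra_monotone : Monotone tetra := monotone_nat_of_le_succ tetra_le_succ

/-- While the iterates stay at least `1`, each logarithm lowers the value by at least `1`. This
excludes the default value of `sInf ∅` in `lnStar`. -/
theorem exists_iterate_log_lt_one (a : ℝ) : ∃ m : ℕ, Real.log^[m] a < 1 := by
  by_contra! h
  have key : ∀ m : ℕ, Real.log^[m] a ≤ a - m := by
    intro m
    induction m with
    | zero => simp
    | succ m ih =>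
      rw [Function.iterate_succ_apply']
      have := Real.log_le_sub_one_of_pos (lt_of_lt_of_le one_pos (h m))
      push_cast
      linarith
  obtain ⟨m, hm⟩ := exists_nat_gt a
  have h1 := key m
  have h2 := h m
  linarith

theorem lt_tetra_of_iterate_log (m : ℕ) (a : ℝ) (h : ∀ i < m, 1 ≤ Real.log^[i] a)
    (hm : Real.log^[m] a < 1) : a < tetra m := by
  induction m generalizing a with
  | zero => exact hm
  | succ m ih =>
    have ha : 1 ≤ a := h 0 (Nat.succ_pos m)
    have h1 : Real.log a < tetra m :=
      ih (Real.log a) (fun i hi => h (i + 1) (by omega)) hm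
    rw [← Real.exp_log (lt_of_lt_of_le one_pos ha)]
    exact Real.exp_lt_exp.2 h1

theorem lt_tetra_lnStar (a : ℝ) : a < tetra (lnStar a) := by
  refine lt_tetra_of_iterate_log _ _ (fun i hi => ?_) (Nat.sInf_mem (exists_iterate_log_lt_one a))
  by_contra! h
  exact Nat.notMem_of_lt_sInf hi h

theorem endpoint_sq (n i : ℕ) : endpoint n i ^ 2 = 3 / n * tetra i :=
  Real.sq_sqrt (mul_nonneg (by positivity) (zero_le_one.trans (one_le_tetra i)))

theorem endpoint_nonneg (n i : ℕ) : 0 ≤ endpoint n i := Real.sqrt_nonneg _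

theorem endpoint_pos {n : ℕ} (hn : 0 < n) (i : ℕ) : 0 < endpoint n i :=
  Real.sqrt_pos.2 (mul_pos (by positivity) (zero_lt_one.trans_le (one_le_tetra i)))

theorem endpoint_monotone (n : ℕ) : Monotone (endpoint n) := fun _ _ h =>
  Real.sqrt_le_sqrt (mul_le_mul_of_nonneg_left (tetra_monotone h) (by positivity))

theorem abs_le_endpoint_intervalIndex {n e : ℕ} {x : ℝ} (hx : |x| ≤ endpoint n (2 ^ e - 1)) :
    |x| ≤ endpoint n (intervalIndex n e x) := by
  have hmem : 2 ^ e - 1 ∈ {j : ℕ | |x| ≤ endpoint n j} := hx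
  have h : min (sInf {j : ℕ | |x| ≤ endpoint n j}) (2 ^ e - 1)
      = sInf {j : ℕ | |x| ≤ endpoint n j} := min_eq_left (Nat.sInf_le hmem)
  have h2 : |x| ≤ endpoint n (sInf {j : ℕ | |x| ≤ endpoint n j}) := Nat.sInf_mem ⟨_, hmem⟩
  simpa only [intervalIndex, h] using h2

/-- True on overflow as well: truncating the index only removes values of `j` below it. -/
theorem endpoint_lt_of_lt_intervalIndex {n e j : ℕ} {x : ℝ}
    (hj : j < (intervalIndex n e x : ℕ)) : endpoint n j < |x| := by
  have h : j < sInf {j : ℕ | |x| ≤ endpoint n j} := lt_of_lt_of_le hj (min_le_left _ _)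
  exact not_le.1 (Nat.notMem_of_lt_sInf h)

/-- Layer-cake bound for the squared endpoint of the chosen interval. -/
theorem tetra_intervalIndex_le (n e : ℕ) (x : ℝ) :
    tetra (intervalIndex n e x) ≤ 1 + ∑ j ∈ Finset.range (2 ^ e - 1),
      if endpoint n j < |x| then tetra (j + 1) - tetra j else 0 := by
  have h1 : tetra (intervalIndex n e x) =
      1 + ∑ j ∈ Finset.range (intervalIndex n e x), (tetra (j + 1) - tetra j) := by
    rw [Finset.sum_range_sub]
    simp [tetra]
  rw [h1]
  gcongr 1 + ?_
  calc ∑ j ∈ Finset.range (intervalIndex n e x), (tetra (j + 1) - tetra j)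
      = ∑ j ∈ Finset.range (intervalIndex n e x),
          if endpoint n j < |x| then tetra (j + 1) - tetra j else 0 := by
        refine Finset.sum_congr rfl fun j hj => ?_
        rw [if_pos (endpoint_lt_of_lt_intervalIndex (Finset.mem_range.1 hj))]
    _ ≤ _ := by
        refine Finset.sum_le_sum_of_subset_of_nonneg ?_ fun j _ _ => ?_
        · intro j hj
          have := (intervalIndex n e x).2
          simp only [Finset.mem_range] at hj ⊢
          omega
        · split_ifs
          · linarith [tetra_le_succ j]
          · exact le_rfl

/-! ### Padding -/

theorem le_padDim (d : ℕ) : d ≤ padDim d := Nat.le_pow_clog one_lt_two d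

theorem padDim_pos (d : ℕ) : 0 < padDim d := by unfold padDim; positivity

theorem padDim_le_two_mul {d : ℕ} (hd : 1 ≤ d) : padDim d ≤ 2 * d := by
  rcases Nat.lt_or_ge 1 d with h | h
  · have hc : 0 < Nat.clog 2 d := Nat.clog_pos one_lt_two h
    have h1 : 2 ^ (Nat.clog 2 d).pred < d := Nat.pow_pred_clog_lt_self one_lt_two h
    have h2 : 2 ^ Nat.clog 2 d = 2 * 2 ^ (Nat.clog 2 d).pred := by
      rw [← pow_succ', ← Nat.succ_eq_add_one, Nat.succ_pred_eq_of_pos hc]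
    unfold padDim
    omega
  · obtain rfl : d = 1 := by omega
    simp [padDim]

theorem sum_pad {d n : ℕ} (h : d ≤ n) (x : E d) (c : Fin n → ℝ → ℝ) (hc : ∀ i, c i 0 = 0) :
    ∑ i, c i (pad n x i) = ∑ i : Fin d, c (Fin.castLE h i) (x i) := by
  symm
  refine Finset.sum_of_injOn (Fin.castLE h) (fun i _ j _ hij => Fin.castLE_injective h hij)
    (fun _ _ => Finset.mem_coe.2 (Finset.mem_univ _)) (fun i _ hi => ?_) (fun i _ => ?_)
  · have : ¬ (i : ℕ) < d := fun hlt => hi ⟨⟨i, hlt⟩, by simp, by ext; rfl⟩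
    simp [pad, this, hc]
  · simp [pad]

theorem pad_dotProduct_pad {d n : ℕ} (h : d ≤ n) (x w : E d) :
    pad n w ⬝ᵥ pad n x = inner ℝ w x := by
  have := sum_pad h x (fun i t => pad n w i * t) (by simp)
  rw [dotProduct, this, PiLp.inner_apply]
  refine Finset.sum_congr rfl fun i _ => ?_
  simp [pad, mul_comm]

theorem inner_unpad {d n : ℕ} (h : d ≤ n) (w : E d) (y : Fin n → ℝ) :
    inner ℝ w (unpad d y) = pad n w ⬝ᵥ y := by
  have := sum_pad h w (fun i t => t * y i) (by simp)
  rw [dotProduct, this, PiLp.inner_apply]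
  refine Finset.sum_congr rfl fun i _ => ?_
  have : (i : ℕ) < n := i.2.trans_le h
  simp only [unpad, this, dif_pos]
  simp [mul_comm, Fin.castLE]

theorem norm_unpad_sq_le {d n : ℕ} (h : d ≤ n) (y : Fin n → ℝ) :
    ‖unpad d y‖ ^ 2 ≤ y ⬝ᵥ y := by
  rw [EuclideanSpace.norm_sq_eq]
  have h1 : ∀ i : Fin d, ‖unpad d y i‖ ^ 2 = y (Fin.castLE h i) * y (Fin.castLE h i) := by
    intro i
    have : (i : ℕ) < n := i.2.trans_le h
    simp only [unpad, this, dif_pos, Real.norm_eq_abs, sq_abs]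
    simp [sq, Fin.castLE]
  rw [Finset.sum_congr rfl fun i _ => h1 i, dotProduct]
  calc ∑ i : Fin d, y (Fin.castLE h i) * y (Fin.castLE h i)
      = ∑ j ∈ Finset.univ.map (Fin.castLEEmb h), y j * y j := by simp
    _ ≤ _ := Finset.sum_le_sum_of_subset_of_nonneg (Finset.subset_univ _)
        fun i _ _ => mul_self_nonneg _

theorem continuous_pad {d : ℕ} (n : ℕ) : Continuous (pad n : E d → Fin n → ℝ) := by
  refine continuous_pi fun i => ?_
  unfold pad
  split_ifs
  · fun_prop
  · exact continuous_const

/-! ### The Walsh-Hadamard matrix and the random rotation -/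

theorem walshHadamard_mul_self (n : ℕ) (i j : Fin n) :
    walshHadamard n i j * walshHadamard n i j = 1 := by
  rw [walshHadamard, ← Finset.prod_mul_distrib]
  refine Finset.prod_eq_one fun m _ => ?_
  split_ifs <;> norm_num

/-- The indices of distinct rows differ in some bit `m`. Flipping bit `m` of the column index is an
involution that changes the sign of exactly one of the two entries, so the sum equals its own
negative. -/
theorem sum_walshHadamard_mul {k : ℕ} (i i' : Fin (2 ^ k)) (hne : i ≠ i') :
    ∑ j, walshHadamard (2 ^ k) i j * walshHadamard (2 ^ k) i' j = 0 := by
  obtain ⟨m, hm⟩ : ∃ m, (i : ℕ).testBit m ≠ (i' : ℕ).testBit m := by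
    by_contra! h
    exact hne (Fin.ext (Nat.eq_of_testBit_eq h))
  have hmk : m < k := by
    by_contra! hk
    have h2 : 2 ^ k ≤ 2 ^ m := Nat.pow_le_pow_right two_pos hk
    rw [Nat.testBit_lt_two_pow (i.2.trans_le h2), Nat.testBit_lt_two_pow (i'.2.trans_le h2)] at hm
    exact hm rfl
  have hmn : m ∈ Finset.range (2 ^ k) := Finset.mem_range.2 (hmk.trans Nat.lt_two_pow_self)
  let τ : Fin (2 ^ k) → Fin (2 ^ k) := fun j =>
    ⟨(j : ℕ) ^^^ 2 ^ m, Nat.xor_lt_two_pow j.2 (Nat.pow_lt_pow_right one_lt_two hmk)⟩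
  have hτ : Function.Involutive τ := fun j => by
    ext
    simp [τ]
  have hbit : ∀ j l, ((τ j : Fin (2 ^ k)) : ℕ).testBit l = ((j : ℕ).testBit l ^^ decide (m = l)) := by
    intro j l
    simp [τ, Nat.testBit_xor, Nat.testBit_two_pow]
  have hflip : ∀ j, walshHadamard (2 ^ k) i (τ j) * walshHadamard (2 ^ k) i' (τ j) =
      -(walshHadamard (2 ^ k) i j * walshHadamard (2 ^ k) i' j) := by
    intro j
    simp only [walshHadamard, ← Finset.prod_mul_distrib]
    rw [← Finset.mul_prod_erase _ _ hmn, ← Finset.mul_prod_erase _ _ hmn, ← neg_mul]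
    congr 1
    · rw [hbit]
      cases h1 : (i : ℕ).testBit m <;> cases h2 : (i' : ℕ).testBit m <;>
        cases h3 : (j : ℕ).testBit m <;> simp_all
    · refine Finset.prod_congr rfl fun l hl => ?_
      have : m ≠ l := (Finset.ne_of_mem_erase hl).symm
      simp [hbit, this]
  have hsum : ∑ j, walshHadamard (2 ^ k) i j * walshHadamard (2 ^ k) i' j =
      ∑ j, -(walshHadamard (2 ^ k) i j * walshHadamard (2 ^ k) i' j) := by
    rw [← Finset.sum_congr rfl fun j _ => hflip j]
    exact (hτ.bijective.sum_comp
      fun j => walshHadamard (2 ^ k) i j * walshHadamard (2 ^ k) i' j).symm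
  rw [Finset.sum_neg_distrib] at hsum
  linarith

theorem walshHadamard_mul_transpose (k : ℕ) :
    walshHadamard (2 ^ k) * (walshHadamard (2 ^ k)).transpose = ((2 : ℝ) ^ k) • 1 := by
  ext i i'
  rw [Matrix.mul_apply]
  simp only [Matrix.transpose_apply, Matrix.smul_apply, Matrix.one_apply, smul_eq_mul]
  split_ifs with h
  · subst h
    simp [walshHadamard_mul_self]
  · rw [sum_walshHadamard_mul i i' h, mul_zero]

/-- The `±1`-valued sign coded by a Boolean. -/
def sgn (s : Bool) : ℝ := if s then 1 else -1

theorem sgn_mul_self (s : Bool) : sgn s * sgn s = 1 := by cases s <;> simp [sgn]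

theorem rotation_apply {n : ℕ} (s : Fin n → Bool) (i j : Fin n) :
    rotation s i j = (√(n : ℝ))⁻¹ * (walshHadamard n i j * sgn (s j)) := by
  simp [rotation, sgn, Matrix.mul_diagonal]

theorem rotation_mul_transpose (k : ℕ) (s : Fin (2 ^ k) → Bool) :
    rotation s * (rotation s).transpose = 1 := by
  ext i i'
  have h := congrFun (congrFun (walshHadamard_mul_transpose k) i) i'
  rw [Matrix.mul_apply] at h ⊢
  simp only [Matrix.transpose_apply, rotation_apply] at h ⊢
  have h2 : ∀ j, (√((2 ^ k : ℕ) : ℝ))⁻¹ * (walshHadamard (2 ^ k) i j * sgn (s j)) *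
      ((√((2 ^ k : ℕ) : ℝ))⁻¹ * (walshHadamard (2 ^ k) i' j * sgn (s j))) =
      ((2 : ℝ) ^ k)⁻¹ * (walshHadamard (2 ^ k) i j * walshHadamard (2 ^ k) i' j) := by
    intro j
    have hs : (√((2 ^ k : ℕ) : ℝ))⁻¹ * (√((2 ^ k : ℕ) : ℝ))⁻¹ = ((2 : ℝ) ^ k)⁻¹ := by
      rw [← mul_inv, Real.mul_self_sqrt (by positivity)]
      norm_num
    rw [← hs]
    linear_combination (√((2 ^ k : ℕ) : ℝ))⁻¹ * (√((2 ^ k : ℕ) : ℝ))⁻¹ *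
      (walshHadamard (2 ^ k) i j * walshHadamard (2 ^ k) i' j) * sgn_mul_self (s j)
  rw [Finset.sum_congr rfl fun j _ => h2 j, ← Finset.mul_sum, h, Matrix.smul_apply, smul_eq_mul,
    ← mul_assoc, inv_mul_cancel₀ (by positivity), one_mul]

theorem rotation_inv {d : ℕ} (s : Fin (padDim d) → Bool) :
    (rotation s)⁻¹ = (rotation s).transpose :=
  Matrix.inv_eq_right_inv (rotation_mul_transpose _ s)

theorem rotation_transpose_mul {d : ℕ} (s : Fin (padDim d) → Bool) :
    (rotation s).transpose * rotation s = 1 :=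
  mul_eq_one_comm.1 (rotation_mul_transpose _ s)

theorem rotation_mulVec_dotProduct {d : ℕ} (s : Fin (padDim d) → Bool) (v w : Fin (padDim d) → ℝ) :
    (rotation s).mulVec v ⬝ᵥ (rotation s).mulVec w = v ⬝ᵥ w := by
  rw [Matrix.dotProduct_mulVec, ← Matrix.mulVec_transpose, Matrix.mulVec_mulVec,
    rotation_transpose_mul, Matrix.one_mulVec]

theorem dotProduct_rotation_inv_mulVec {d : ℕ} (s : Fin (padDim d) → Bool)
    (v w : Fin (padDim d) → ℝ) :
    v ⬝ᵥ ((rotation s)⁻¹).mulVec w = (rotation s).mulVec v ⬝ᵥ w := by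
  rw [rotation_inv, Matrix.dotProduct_mulVec, Matrix.vecMul_transpose]

theorem rotation_inv_mulVec_dotProduct_self {d : ℕ} (s : Fin (padDim d) → Bool)
    (w : Fin (padDim d) → ℝ) :
    ((rotation s)⁻¹).mulVec w ⬝ᵥ ((rotation s)⁻¹).mulVec w = w ⬝ᵥ w := by
  rw [dotProduct_rotation_inv_mulVec, rotation_inv, Matrix.mulVec_mulVec,
    mul_eq_one_comm.1 (rotation_transpose_mul s), Matrix.one_mulVec]

/-- The rotated padded vector as a signed sum. -/
theorem rotation_mulVec_pad {d n : ℕ} (h : d ≤ n) (s : Fin n → Bool) (x : E d) (i : Fin n) :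
    (rotation s).mulVec (pad n x) i =
      ∑ j : Fin d, rotation s i (Fin.castLE h j) * x j :=
  sum_pad h x (fun j t => rotation s i j * t) (by simp)

/-- Cauchy-Schwarz over the `d` entries that are not padding, each matrix entry having square `1/n`.
The factor `d/n`, rather than `1`, is why `ln* (d/3)` gives enough intervals even after padding. -/
theorem rotation_mulVec_pad_sq_le {d n : ℕ} (h : d ≤ n) (s : Fin n → Bool) (x : E d)
    (i : Fin n) : (rotation s).mulVec (pad n x) i ^ 2 ≤ d / n * ‖x‖ ^ 2 := by
  rw [rotation_mulVec_pad h, EuclideanSpace.norm_sq_eq]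
  refine (Finset.sum_mul_sq_le_sq_mul_sq _ _ _).trans (le_of_eq ?_)
  congr 1
  · have : ∀ j, rotation s i j ^ 2 = (n : ℝ)⁻¹ := by
      intro j
      rw [rotation_apply, mul_pow, mul_pow, inv_pow, Real.sq_sqrt (Nat.cast_nonneg n), sq, sq,
        walshHadamard_mul_self, sgn_mul_self, one_mul, mul_one]
    simp [this, div_eq_mul_inv]
  · simp

theorem sum_rotation_mulVec_pad_sq {d : ℕ} (s : Fin (padDim d) → Bool) (x : E d) :
    ∑ i, (rotation s).mulVec (pad (padDim d) x) i ^ 2 = ‖x‖ ^ 2 := by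
  have h := rotation_mulVec_dotProduct s (pad (padDim d) x) (pad (padDim d) x)
  rw [pad_dotProduct_pad (le_padDim d), real_inner_self_eq_norm_sq] at h
  rw [← h, dotProduct]
  exact Finset.sum_congr rfl fun i _ => sq _

theorem lnStar_le_two_pow_hBits (d : ℕ) : lnStar ((d : ℝ) / 3) ≤ 2 ^ hBits d - 1 := by
  have : 1 + lnStar ((d : ℝ) / 3) ≤ 2 ^ hBits d := Nat.le_pow_clog one_lt_two _
  omega

/-- A coordinate of a rotated vector of norm at most one lies in the largest interval. -/
theorem abs_rotation_mulVec_pad_le {d : ℕ} (s : Fin (padDim d) → Bool) (x : E d) (hx : ‖x‖ ≤ 1)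
    (i : Fin (padDim d)) :
    |(rotation s).mulVec (pad (padDim d) x) i| ≤ endpoint (padDim d) (2 ^ hBits d - 1) := by
  refine abs_le_of_sq_le_sq ?_ (endpoint_nonneg _ _)
  rw [endpoint_sq]
  have h1 := rotation_mulVec_pad_sq_le (le_padDim d) s x i
  have h2 : (d : ℝ) / 3 ≤ tetra (2 ^ hBits d - 1) :=
    (lt_tetra_lnStar _).le.trans (tetra_monotone (lnStar_le_two_pow_hBits d))
  have hn : (0 : ℝ) < padDim d := by exact_mod_cast padDim_pos d
  have h3 : ‖x‖ ^ 2 ≤ 1 := pow_le_one₀ (norm_nonneg _) hx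
  calc _ ≤ (d : ℝ) / padDim d * ‖x‖ ^ 2 := h1
    _ ≤ (d : ℝ) / padDim d * 1 := by gcongr
    _ = 3 / padDim d * ((d : ℝ) / 3) := by field_simp
    _ ≤ _ := by gcongr

/-! ### Sign sums -/

/-- The sum over sign patterns factors into terms `2 cosh (a j)`, and `cosh t ≤ exp (t²/2)`. -/
theorem sum_exp_sgn_le {n : ℕ} (a : Fin n → ℝ) :
    ∑ s : Fin n → Bool, Real.exp (∑ j, sgn (s j) * a j) ≤
      2 ^ n * Real.exp ((∑ j, a j ^ 2) / 2) := by
  have h1 : ∑ s : Fin n → Bool, Real.exp (∑ j, sgn (s j) * a j) =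
      ∏ j, ∑ t : Bool, Real.exp (sgn t * a j) := by
    rw [Finset.prod_univ_sum]
    simp only [Fintype.piFinset_univ, Real.exp_sum]
  rw [h1, Finset.sum_div, Real.exp_sum]
  calc ∏ j, ∑ t : Bool, Real.exp (sgn t * a j)
      ≤ ∏ j, (2 * Real.exp (a j ^ 2 / 2)) := by
        refine Finset.prod_le_prod (fun j _ => by positivity) fun j _ => ?_
        have := Real.cosh_le_exp_half_sq (a j)
        rw [Real.cosh_eq] at this
        simp only [Fintype.sum_bool, sgn]
        norm_num
        linarith
    _ = _ := by rw [Finset.prod_mul_distrib]; simp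

/-- Chernoff's method; `l = M / c` minimizes the exponent `-l M + l² c / 2`. -/
theorem card_lt_sgn_sum_le {n : ℕ} (a : Fin n → ℝ) {c M : ℝ} (hc : 0 < c) (hM : 0 ≤ M)
    (ha : ∑ j, a j ^ 2 ≤ c) :
    ∑ s : Fin n → Bool, (if M < ∑ j, sgn (s j) * a j then (1 : ℝ) else 0) ≤
      2 ^ n * Real.exp (-(M ^ 2 / (2 * c))) := by
  set l : ℝ := M / c with hl
  have hl0 : 0 ≤ l := by positivity
  calc ∑ s : Fin n → Bool, (if M < ∑ j, sgn (s j) * a j then (1 : ℝ) else 0)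
      ≤ ∑ s : Fin n → Bool, Real.exp (-(l * M)) * Real.exp (∑ j, sgn (s j) * (l * a j)) := by
        refine Finset.sum_le_sum fun s _ => ?_
        rw [← Real.exp_add]
        split_ifs with h
        · refine Real.one_le_exp ?_
          have : ∑ j, sgn (s j) * (l * a j) = l * ∑ j, sgn (s j) * a j := by
            rw [Finset.mul_sum]
            exact Finset.sum_congr rfl fun j _ => by ring
          rw [this]
          nlinarith
        · positivity
    _ ≤ Real.exp (-(l * M)) * (2 ^ n * Real.exp ((∑ j, (l * a j) ^ 2) / 2)) := by
        rw [← Finset.mul_sum]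
        gcongr
        exact sum_exp_sgn_le _
    _ = 2 ^ n * Real.exp (-(l * M) + (∑ j, (l * a j) ^ 2) / 2) := by rw [Real.exp_add]; ring
    _ ≤ _ := by
        gcongr
        have : ∑ j, (l * a j) ^ 2 = l ^ 2 * ∑ j, a j ^ 2 := by
          rw [Finset.mul_sum]
          exact Finset.sum_congr rfl fun j _ => by ring
        rw [this]
        calc -(l * M) + l ^ 2 * (∑ j, a j ^ 2) / 2 ≤ -(l * M) + l ^ 2 * c / 2 := by gcongr
          _ = -(M ^ 2 / (2 * c)) := by rw [hl]; field_simp; ring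

/-- Sub-Gaussian tail of a coordinate of the rotated vector. -/
theorem card_endpoint_lt_le {d n : ℕ} (hdn : d ≤ n) (hn0 : 0 < n) (x : E d) (hx : ‖x‖ ≤ 1)
    (i : Fin n) (j : ℕ) :
    ∑ s : Fin n → Bool,
      (if endpoint n j < |(rotation s).mulVec (pad n x) i| then (1 : ℝ) else 0) ≤
      2 ^ n * (2 * Real.exp (-(3 / 2 * tetra j))) := by
  have hn : (0 : ℝ) < n := by exact_mod_cast hn0
  let a : Fin n → ℝ := fun l => (√(n : ℝ))⁻¹ * (walshHadamard n i l * pad n x l)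
  have hy : ∀ s : Fin n → Bool, (rotation s).mulVec (pad n x) i = ∑ l, sgn (s l) * a l := by
    intro s
    rw [Matrix.mulVec, dotProduct]
    refine Finset.sum_congr rfl fun l _ => ?_
    rw [rotation_apply]
    simp only [a]
    ring
  have ha : ∑ l, a l ^ 2 ≤ (n : ℝ)⁻¹ := by
    have h1 : ∀ l, a l ^ 2 = (n : ℝ)⁻¹ * (pad n x l * pad n x l) := by
      intro l
      simp only [a]
      rw [mul_pow, mul_pow, inv_pow, Real.sq_sqrt hn.le, sq (walshHadamard n i l),
        walshHadamard_mul_self]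
      ring
    have h2 := pad_dotProduct_pad hdn x x
    rw [real_inner_self_eq_norm_sq, dotProduct] at h2
    rw [Finset.sum_congr rfl fun l _ => h1 l, ← Finset.mul_sum, h2]
    have : ‖x‖ ^ 2 ≤ 1 := pow_le_one₀ (norm_nonneg _) hx
    nlinarith [inv_pos.2 hn]
  have hM := endpoint_nonneg n j
  have hexp : endpoint n j ^ 2 / (2 * (n : ℝ)⁻¹) = 3 / 2 * tetra j := by
    rw [endpoint_sq]; field_simp
  have h1 := card_lt_sgn_sum_le a (inv_pos.2 hn) hM ha
  have h2 := card_lt_sgn_sum_le (fun l => -a l) (inv_pos.2 hn) hM (by simpa using ha)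
  rw [hexp] at h1 h2
  calc _ ≤ ∑ s : Fin n → Bool, ((if endpoint n j < ∑ l, sgn (s l) * a l then (1 : ℝ) else 0) +
        (if endpoint n j < ∑ l, sgn (s l) * -a l then (1 : ℝ) else 0)) := by
        refine Finset.sum_le_sum fun s _ => ?_
        rw [hy s]
        have hneg : ∑ l, sgn (s l) * -a l = -∑ l, sgn (s l) * a l := by simp
        rw [hneg]
        by_cases h : endpoint n j < |∑ l, sgn (s l) * a l|
        · rw [if_pos h]
          rcases lt_abs.1 h with h | h
          · rw [if_pos h]; split_ifs <;> norm_num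
          · rw [if_pos h]; split_ifs <;> norm_num
        · rw [if_neg h]; split_ifs <;> norm_num
    _ ≤ _ := by
        rw [Finset.sum_add_distrib]
        linarith

theorem tetra_one : tetra 1 = Real.exp 1 := rfl

theorem exp_neg_half_tetra_one_le : Real.exp (-(tetra 1 / 2)) ≤ 0.2572 := by
  rw [tetra_one]
  have he := Real.exp_one_gt_d9
  have h1 : Real.exp (0.359 : ℝ) ≥ 1.431 := by
    have := Real.sum_le_exp_of_nonneg (by norm_num : (0 : ℝ) ≤ 0.359) 4
    norm_num [Finset.sum_range_succ, Nat.factorial] at this ⊢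
    linarith
  have h2 : Real.exp (Real.exp 1 / 2) ≥ 3.889 := by
    have : Real.exp (Real.exp 1 / 2) ≥ Real.exp (1 + 0.359) := by
      gcongr
      linarith
    rw [Real.exp_add] at this
    nlinarith
  rw [Real.exp_neg, inv_le_comm₀ (Real.exp_pos _) (by norm_num)]
  norm_num at h2 ⊢
  linarith

theorem exp_neg_half_tetra_le {j : ℕ} (hj : 2 ≤ j) : Real.exp (-(tetra j / 2)) ≤ 0.001 := by
  have h2 : (14 : ℝ) ≤ tetra 2 := by
    have he := Real.exp_one_gt_d9
    have h1 : Real.exp 1 * (Real.exp 1 * Real.exp (0.7 : ℝ)) ≤ tetra 2 := by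
      rw [← Real.exp_add, ← Real.exp_add]
      change _ ≤ Real.exp (Real.exp 1)
      gcongr
      linarith
    have h3 : Real.exp (0.7 : ℝ) ≥ 1.945 := by
      have := Real.sum_le_exp_of_nonneg (by norm_num : (0 : ℝ) ≤ 0.7) 3
      norm_num [Finset.sum_range_succ, Nat.factorial] at this ⊢
      linarith
    nlinarith [mul_pos (Real.exp_pos 1) (Real.exp_pos 1)]
  have h3 : (14 : ℝ) ≤ tetra j := h2.trans (tetra_monotone hj)
  have he := Real.exp_one_gt_d9
  have h7 : (1000 : ℝ) ≤ Real.exp (tetra j / 2) := by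
    calc (1000 : ℝ) ≤ 2.7182818283 ^ 7 := by norm_num
      _ ≤ Real.exp 1 ^ 7 := by gcongr
      _ = Real.exp 7 := by rw [← Real.exp_nat_mul]; norm_num
      _ ≤ _ := by gcongr; linarith
  rw [Real.exp_neg, inv_le_comm₀ (Real.exp_pos _) (by norm_num)]
  norm_num at h7 ⊢
  linarith

/-- The mean of the squared endpoints of the chosen intervals, up to normalization. -/
theorem sum_tetra_intervalIndex_le {d : ℕ} (he : hBits d ≤ 3) (x : E d) (hx : ‖x‖ ≤ 1) :
    ∑ s : Fin (padDim d) → Bool, ∑ i,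
      tetra (intervalIndex (padDim d) (hBits d) ((rotation s).mulVec (pad (padDim d) x) i)) ≤
      2 ^ padDim d * (padDim d * 2.1) := by
  set n := padDim d with hndef
  have hn : (0 : ℝ) < n := by exact_mod_cast padDim_pos d
  let y : (Fin n → Bool) → Fin n → ℝ := fun s i => (rotation s).mulVec (pad n x) i
  let I : (Fin n → Bool) → Fin n → ℕ → ℝ :=
    fun s i j => if endpoint n j < |y s i| then (1 : ℝ) else 0
  let w : ℕ → ℝ := fun j => tetra (j + 1) - tetra j
  have hw : ∀ j, 0 ≤ w j := fun j => sub_nonneg.2 (tetra_le_succ j)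
  have hI : ∀ s i j, 0 ≤ I s i j := fun s i j => by simp only [I]; split_ifs <;> norm_num
  have hpt : ∀ s i, tetra (intervalIndex n (hBits d) (y s i)) ≤
      1 + ∑ j ∈ Finset.range 7, w j * I s i j := by
    intro s i
    refine (tetra_intervalIndex_le _ _ _).trans ?_
    gcongr 1 + ?_
    -- At most eight intervals, hence at most seven layers.
    have h7 : 2 ^ hBits d - 1 ≤ 7 := by
      have : 2 ^ hBits d ≤ 2 ^ 3 := Nat.pow_le_pow_right two_pos he
      omega
    calc _ = ∑ j ∈ Finset.range (2 ^ hBits d - 1), w j * I s i j := by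
          refine Finset.sum_congr rfl fun j _ => ?_
          simp only [I, w, mul_ite, mul_one, mul_zero]
      _ ≤ _ := Finset.sum_le_sum_of_subset_of_nonneg (Finset.range_mono h7)
          fun j _ _ => mul_nonneg (hw j) (hI s i j)
  have hcard : ∑ s : Fin n → Bool, ∑ i : Fin n, (1 : ℝ) = 2 ^ n * n := by simp
  -- The lowest layer is counted instead: the squares sum to at most `1`, so at most `n/3`
  -- coordinates have square above `3/n`. The sub-Gaussian bound `2 exp (-3/2)` exceeds `1/3` and
  -- would not give the constant `2.1`.
  have h0 : ∑ s : Fin n → Bool, ∑ i : Fin n, I s i 0 ≤ 2 ^ n * (n / 3) := by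
    have : ∀ s : Fin n → Bool, ∑ i : Fin n, I s i 0 ≤ n / 3 := by
      intro s
      calc ∑ i : Fin n, I s i 0 ≤ ∑ i : Fin n, (n : ℝ) / 3 * y s i ^ 2 := by
            refine Finset.sum_le_sum fun i _ => ?_
            simp only [I]
            split_ifs with h
            · have h1 : endpoint n 0 ^ 2 ≤ y s i ^ 2 := by
                rw [← sq_abs (y s i)]
                have := endpoint_nonneg n 0
                gcongr
              rw [endpoint_sq] at h1
              simp only [tetra, mul_one] at h1
              calc (1 : ℝ) = n / 3 * (3 / n) := by field_simp
                _ ≤ _ := by gcongr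
            · positivity
        _ = n / 3 * ‖x‖ ^ 2 := by rw [← Finset.mul_sum, sum_rotation_mulVec_pad_sq]
        _ ≤ n / 3 * 1 := by
            gcongr
            exact pow_le_one₀ (norm_nonneg _) hx
        _ = _ := mul_one _
    calc _ ≤ ∑ s : Fin n → Bool, (n : ℝ) / 3 := Finset.sum_le_sum fun s _ => this s
      _ = _ := by simp
  -- The weight is at most `exp (e^{*j})` and the tail carries `exp (-(3/2) e^{*j})`; half of the
  -- exponent survives. The `3` in the endpoints serves this purpose.
  have hj : ∀ j, w j * ∑ s : Fin n → Bool, ∑ i : Fin n, I s i j ≤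
      2 ^ n * n * (2 * Real.exp (-(tetra j / 2))) := by
    intro j
    have h1 : ∑ s : Fin n → Bool, ∑ i : Fin n, I s i j ≤
        n * (2 ^ n * (2 * Real.exp (-(3 / 2 * tetra j)))) := by
      rw [Finset.sum_comm]
      calc _ ≤ ∑ i : Fin n, 2 ^ n * (2 * Real.exp (-(3 / 2 * tetra j))) :=
            Finset.sum_le_sum fun i _ => card_endpoint_lt_le (le_padDim d) (padDim_pos d) x hx i j
        _ = _ := by simp
    have h2 : w j ≤ Real.exp (tetra j) := by
      have := one_le_tetra j
      simp only [w, tetra]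
      linarith
    calc _ ≤ Real.exp (tetra j) * (n * (2 ^ n * (2 * Real.exp (-(3 / 2 * tetra j))))) := by
          gcongr
      _ = 2 ^ n * n * (2 * (Real.exp (tetra j) * Real.exp (-(3 / 2 * tetra j)))) := by ring
      _ = _ := by rw [← Real.exp_add]; ring_nf
  have hw0 : w 0 ≤ 1.71829 := by
    have := Real.exp_one_lt_d9
    simp only [w, tetra]
    linarith
  calc ∑ s : Fin n → Bool, ∑ i, tetra (intervalIndex n (hBits d) (y s i))
      ≤ ∑ s : Fin n → Bool, ∑ i : Fin n, (1 + ∑ j ∈ Finset.range 7, w j * I s i j) :=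
        Finset.sum_le_sum fun s _ => Finset.sum_le_sum fun i _ => hpt s i
    _ = 2 ^ n * n + ∑ j ∈ Finset.range 7, w j * ∑ s : Fin n → Bool, ∑ i : Fin n, I s i j := by
        simp only [Finset.sum_add_distrib, hcard]
        congr 1
        simp only [Finset.mul_sum]
        calc _ = ∑ s : Fin n → Bool, ∑ j ∈ Finset.range 7, ∑ i : Fin n, w j * I s i j :=
              Finset.sum_congr rfl fun s _ => Finset.sum_comm
          _ = _ := Finset.sum_comm
    _ = 2 ^ n * n + (∑ j ∈ Finset.range 6, w (j + 1) * ∑ s : Fin n → Bool, ∑ i : Fin n,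
          I s i (j + 1) + w 0 * ∑ s : Fin n → Bool, ∑ i : Fin n, I s i 0) := by
        rw [Finset.sum_range_succ']
    _ ≤ 2 ^ n * n + (∑ j ∈ Finset.range 6, 2 ^ n * n * (2 * Real.exp (-(tetra (j + 1) / 2))) +
          1.71829 * (2 ^ n * (n / 3))) := by
        refine add_le_add le_rfl (add_le_add (Finset.sum_le_sum fun j _ => hj _) ?_)
        gcongr
    -- `0.5244 = 2 · 0.2572 + 5 · 2 · 0.001`: layer `1`, then layers `2` to `6`. In the end `1 +
    -- 0.5244 + 1.71829/3 < 2.1`.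
    _ ≤ 2 ^ n * n + (2 ^ n * n * 0.5244 + 1.71829 * (2 ^ n * (n / 3))) := by
        rw [← Finset.mul_sum]
        gcongr
        rw [Finset.sum_range_succ']
        have h1 := exp_neg_half_tetra_one_le
        have h2 : ∑ j ∈ Finset.range 5, 2 * Real.exp (-(tetra (j + 1 + 1) / 2)) ≤
            ∑ j ∈ Finset.range 5, 2 * 0.001 := by
          gcongr
          exact exp_neg_half_tetra_le (by omega)
        norm_num at h1 h2 ⊢
        linarith
    _ ≤ _ := by
        have : (0 : ℝ) < 2 ^ n * n := by positivity
        nlinarith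

/-! ### Stochastic uniform quantization -/

theorem measurable_of_val_comp {α : Type*} [MeasurableSpace α] {m : ℕ} [NeZero m] {f : α → Fin m}
    (hf : Measurable fun a => (f a : ℕ)) : Measurable f := by
  have : f = (fun k : ℕ => Fin.ofNat m k) ∘ fun a => (f a : ℕ) := by
    funext a
    simp
  rw [this]
  exact (measurable_of_countable _).comp hf

theorem measurable_intervalIndex (n e : ℕ) : Measurable (intervalIndex n e) := by
  refine measurable_to_countable' fun j => ?_
  have hmono : ∀ i : ℕ, MeasurableSet {x : ℝ | i ≤ (intervalIndex n e x : ℕ)} := by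
    intro i
    -- The last factor accounts for `sInf ∅ = 0`: if no endpoint bounds `|x|`, the index is `0`.
    have : {x : ℝ | i ≤ (intervalIndex n e x : ℕ)} =
        {x : ℝ | i ≤ 2 ^ e - 1} ∩ ({x : ℝ | ∀ k < i, ¬ |x| ≤ endpoint n k} ∩
          ({x : ℝ | i = 0} ∪ {x : ℝ | ∃ k, |x| ≤ endpoint n k})) := by
      ext x
      simp only [intervalIndex, le_min_iff, Set.mem_ofPred_eq, Set.mem_inter_iff, Set.mem_union]
      constructor
      · rintro ⟨h1, h2⟩
        refine ⟨h2, fun k hk => Nat.notMem_of_lt_sInf (hk.trans_le h1), ?_⟩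
        by_cases h0 : i = 0
        · exact Or.inl h0
        · right
          by_contra hne
          push Not at hne
          have : {j : ℕ | |x| ≤ endpoint n j} = ∅ := by
            ext k; simpa using hne k
          rw [this, Nat.sInf_empty] at h1
          omega
      · rintro ⟨h1, h2, h3⟩
        refine ⟨?_, h1⟩
        rcases h3 with h3 | ⟨k, hk⟩
        · omega
        · have hmem : sInf {j : ℕ | |x| ≤ endpoint n j} ∈ {j : ℕ | |x| ≤ endpoint n j} :=
            Nat.sInf_mem ⟨k, hk⟩
          by_contra! hlt
          exact h2 _ hlt hmem
    rw [this]
    have hc : ∀ k, MeasurableSet {x : ℝ | |x| ≤ endpoint n k} := fun k =>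
      measurableSet_le measurable_id.abs measurable_const
    refine (MeasurableSet.const _).inter (MeasurableSet.inter ?_ ((MeasurableSet.const _).union ?_))
    · simp only [Set.ofPred_forall]
      exact MeasurableSet.iInter fun k => MeasurableSet.iInter fun _ => (hc k).compl
    · simp only [Set.ofPred_exists]
      exact MeasurableSet.iUnion hc
  have : intervalIndex n e ⁻¹' {j} = {x | (j : ℕ) ≤ intervalIndex n e x} \
      {x | (j : ℕ) + 1 ≤ intervalIndex n e x} := by
    ext x
    simp only [Set.mem_preimage, Set.mem_singleton_iff, Set.mem_sdiff, Set.mem_ofPred_eq, Fin.ext_iff]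
    omega
  rw [this]
  exact (hmono _).diff (hmono _)

theorem measurable_levelIndex (M : ℝ) (κ : ℕ) (hκ : 1 ≤ κ) :
    Measurable fun q : unitInterval × ℝ => levelIndex M κ hκ q.1 q.2 := by
  have hleft : Measurable fun x : ℝ => leftLevel M (2 ^ κ) x := by
    unfold leftLevel
    have h1 : Measurable fun x : ℝ => ⌊(x + M) / (2 * M / (((2 ^ κ : ℕ) : ℝ) - 1))⌋₊ :=
      Nat.measurable_floor.comp (by fun_prop)
    exact h1.min measurable_const
  have hlev : ∀ c : ℕ, Measurable fun x : ℝ => level M (2 ^ κ) (leftLevel M (2 ^ κ) x + c) := by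
    intro c
    exact (measurable_of_countable fun l : ℕ => level M (2 ^ κ) (l + c)).comp hleft
  have hl2 : Measurable fun q : unitInterval × ℝ => leftLevel M (2 ^ κ) q.2 :=
    hleft.comp measurable_snd
  have hset : MeasurableSet {q : unitInterval × ℝ | (q.1 : ℝ) <
      (q.2 - level M (2 ^ κ) (leftLevel M (2 ^ κ) q.2)) /
      (level M (2 ^ κ) (leftLevel M (2 ^ κ) q.2 + 1) -
        level M (2 ^ κ) (leftLevel M (2 ^ κ) q.2))} := by
    refine measurableSet_lt (measurable_subtype_coe.comp measurable_fst) ?_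
    have h0 := (hlev 0).comp (measurable_snd : Measurable (Prod.snd : unitInterval × ℝ → ℝ))
    have h1 := (hlev 1).comp (measurable_snd : Measurable (Prod.snd : unitInterval × ℝ → ℝ))
    exact (measurable_snd.sub h0).div (h1.sub h0)
  refine measurable_of_val_comp ?_
  have : (fun q : unitInterval × ℝ => (levelIndex M κ hκ q.1 q.2 : ℕ)) = fun q =>
      if (q.1 : ℝ) < (q.2 - level M (2 ^ κ) (leftLevel M (2 ^ κ) q.2)) /
        (level M (2 ^ κ) (leftLevel M (2 ^ κ) q.2 + 1) -
          level M (2 ^ κ) (leftLevel M (2 ^ κ) q.2))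
      then leftLevel M (2 ^ κ) q.2 + 1 else leftLevel M (2 ^ κ) q.2 := by
    funext q
    unfold levelIndex
    split_ifs <;> rfl
  rw [this]
  exact Measurable.ite hset ((measurable_of_countable fun l : ℕ => l + 1).comp hl2) hl2

theorem integral_unitInterval_ite {p : ℝ} (h0 : 0 ≤ p) (h1 : p ≤ 1) (a b : ℝ) :
    ∫ v : unitInterval, (if (v : ℝ) < p then a else b) = p * a + (1 - p) * b := by
  have hset : MeasurableSet (Set.Iio (⟨p, h0, h1⟩ : unitInterval)) := measurableSet_Iio
  have hvol : volume.real (Set.Iio (⟨p, h0, h1⟩ : unitInterval)) = p := by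
    rw [measureReal_def, unitInterval.volume_Iio, ENNReal.toReal_ofReal h0]
  have : (fun v : unitInterval => if (v : ℝ) < p then a else b) =
      fun v => (Set.Iio (⟨p, h0, h1⟩ : unitInterval)).indicator (fun _ => a - b) v + b := by
    funext v
    by_cases h : (v : ℝ) < p
    · rw [if_pos h, Set.indicator_of_mem (show v ∈ Set.Iio (⟨p, h0, h1⟩ : unitInterval) from h)]; ring
    · rw [if_neg h, Set.indicator_of_notMem (show v ∉ Set.Iio (⟨p, h0, h1⟩ : unitInterval) from h)]; ring
  rw [this, integral_add ((integrable_const _).indicator hset) (integrable_const _),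
    integral_indicator hset, setIntegral_const, hvol]
  simp
  ring

/-- Left end of the sub-interval containing `x`. -/
theorem level_leftLevel_bounds {M x : ℝ} (hM : 0 < M) {k : ℕ} (hk : 2 ≤ k) (hx : |x| ≤ M) :
    level M k (leftLevel M k x) ≤ x ∧ x ≤ level M k (leftLevel M k x + 1) := by
  have hk1 : (0 : ℝ) < (k : ℝ) - 1 := by
    have : (2 : ℝ) ≤ k := by exact_mod_cast hk
    linarith
  set Δ : ℝ := 2 * M / ((k : ℝ) - 1) with hΔ
  have hΔ0 : 0 < Δ := by positivity
  obtain ⟨hx1, hx2⟩ := abs_le.1 hx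
  have hq0 : 0 ≤ (x + M) / Δ := div_nonneg (by linarith) hΔ0.le
  have hfl := Nat.floor_le hq0
  have hfl2 := Nat.lt_floor_add_one ((x + M) / Δ)
  rw [le_div_iff₀ hΔ0] at hfl
  rw [div_lt_iff₀ hΔ0] at hfl2
  unfold level leftLevel
  rw [← hΔ]
  push_cast
  constructor
  · have : (((min ⌊(x + M) / Δ⌋₊ (k - 2) : ℕ) : ℝ)) ≤ (⌊(x + M) / Δ⌋₊ : ℝ) := by
      exact_mod_cast min_le_left _ _
    push_cast at this
    nlinarith
  · rcases le_total ⌊(x + M) / Δ⌋₊ (k - 2) with h | h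
    · rw [min_eq_left (by exact_mod_cast h)]
      linarith
    -- The cap `k - 2` matters at `x = M`, where the floor is `k - 1`; the right end is then `M`
    -- itself.
    · rw [min_eq_right (by exact_mod_cast h), Nat.cast_sub hk]
      have : ((k : ℝ) - 1) * Δ = 2 * M := by rw [hΔ]; field_simp
      push_cast
      nlinarith

theorem abs_level_le {M : ℝ} (hM : 0 ≤ M) {k l : ℕ} (hl : l < k) (hk : 2 ≤ k) :
    |level M k l| ≤ M := by
  have hk1 : (0 : ℝ) < (k : ℝ) - 1 := by
    have : (2 : ℝ) ≤ k := by exact_mod_cast hk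
    linarith
  have h1 : (l : ℝ) ≤ (k : ℝ) - 1 := by
    have : (l : ℝ) + 1 ≤ k := by exact_mod_cast hl
    linarith
  have h2 : (l : ℝ) * (2 * M / ((k : ℝ) - 1)) ≤ 2 * M := by
    rw [mul_div_assoc', div_le_iff₀ hk1]
    nlinarith
  have h3 : 0 ≤ (l : ℝ) * (2 * M / ((k : ℝ) - 1)) := by positivity
  unfold level
  rw [abs_le]
  constructor <;> linarith

theorem two_le_two_pow {κ : ℕ} (hκ : 1 ≤ κ) : 2 ≤ 2 ^ κ := by
  calc 2 = 2 ^ 1 := by norm_num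
    _ ≤ 2 ^ κ := Nat.pow_le_pow_right (by norm_num) hκ

/-- The rounded value has a two-point law on neighbouring levels `L`, `R`. Leaving `F` free yields
both the mean and the second moment. -/
theorem integral_comp_levelIndex {M x : ℝ} (hM : 0 < M) {κ : ℕ} (hκ : 1 ≤ κ) (hx : |x| ≤ M)
    (F : ℝ → ℝ) :
    ∃ p L R : ℝ, 0 ≤ p ∧ p ≤ 1 ∧ R - L = 2 * M / (2 ^ κ - 1) ∧ x = L + p * (R - L) ∧
      (κ = 1 → L = -M ∧ R = M) ∧
      ∫ v, F (level M (2 ^ κ) (levelIndex M κ hκ v x)) = p * F R + (1 - p) * F L := by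
  have hk := two_le_two_pow hκ
  have hk1 : (0 : ℝ) < (2 : ℝ) ^ κ - 1 := by
    have : (2 : ℝ) ≤ (2 : ℝ) ^ κ := by exact_mod_cast hk
    linarith
  obtain ⟨h1, h2⟩ := level_leftLevel_bounds hM hk hx
  set L := level M (2 ^ κ) (leftLevel M (2 ^ κ) x) with hL
  set R := level M (2 ^ κ) (leftLevel M (2 ^ κ) x + 1) with hR
  have hRL : R - L = 2 * M / (2 ^ κ - 1) := by
    rw [hR, hL]
    unfold level
    push_cast
    ring
  have hpos : 0 < R - L := by rw [hRL]; positivity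
  have hp0 : 0 ≤ (x - L) / (R - L) := div_nonneg (by linarith) hpos.le
  have hp1 : (x - L) / (R - L) ≤ 1 := (div_le_one hpos).2 (by linarith)
  refine ⟨(x - L) / (R - L), L, R, hp0, hp1, hRL, by field_simp; ring, ?_, ?_⟩
  · rintro rfl
    have h0 : leftLevel M (2 ^ 1) x = 0 := by simp [leftLevel]
    rw [hL, hR, h0]
    unfold level
    norm_num
    ring
  · rw [← integral_unitInterval_ite hp0 hp1]
    congr 1
    funext v
    unfold levelIndex
    rw [← hL, ← hR]
    split_ifs <;> rfl

theorem integral_level {M x : ℝ} (hM : 0 < M) {κ : ℕ} (hκ : 1 ≤ κ) (hx : |x| ≤ M) :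
    ∫ v, level M (2 ^ κ) (levelIndex M κ hκ v x) = x := by
  obtain ⟨p, L, R, _, _, _, hxe, _, hint⟩ := integral_comp_levelIndex hM hκ hx id
  simp only [id] at hint
  rw [hint, hxe]
  ring

/-- Second-moment bound of the quantizer with `2 ^ κ` levels, in terms of the squares of the
input and of the endpoint of the interval. -/
def quantSq (κ : ℕ) (y M2 : ℝ) : ℝ := if κ = 1 then M2 else y ^ 2 + M2 / (2 ^ κ - 1) ^ 2

/-- A two-point law has variance `p (1 - p) (R - L)² ≤ (R - L)² / 4`. With only two levels the
output is `±M`, whose square `M²` improves on the general bound `x² + M²`. -/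
theorem integral_level_sq_le {M x : ℝ} (hM : 0 < M) {κ : ℕ} (hκ : 1 ≤ κ) (hx : |x| ≤ M) :
    ∫ v, level M (2 ^ κ) (levelIndex M κ hκ v x) ^ 2 ≤ quantSq κ x (M ^ 2) := by
  obtain ⟨p, L, R, hp0, hp1, hRL, hxe, h1, hint⟩ :=
    integral_comp_levelIndex hM hκ hx fun t => t ^ 2
  rw [hint, quantSq]
  split_ifs with h
  · obtain ⟨rfl, rfl⟩ := h1 h
    exact le_of_eq (by ring)
  · have h2 : M ^ 2 / (2 ^ κ - 1) ^ 2 = (R - L) ^ 2 / 4 := by rw [hRL, div_pow]; ring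
    rw [h2, hxe]
    nlinarith [mul_nonneg (sq_nonneg (R - L)) (sq_nonneg (2 * p - 1))]

/-! ### Uniform subsets -/

instance (n b : ℕ) : Fintype (Subsample n b) :=
  inferInstanceAs (Fintype {S : Finset (Fin n) // S.card = b})

instance (n b : ℕ) : DiscreteMeasurableSpace (Subsample n b) := ⟨fun _ => trivial⟩

theorem nonempty_subsample {n b : ℕ} (h : b ≤ n) : Nonempty (Subsample n b) := by
  obtain ⟨S, _, hS⟩ := Finset.exists_subset_card_eq (s := (Finset.univ : Finset (Fin n))) (n := b)
    (by simpa using h)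
  exact ⟨⟨S, hS⟩⟩

theorem card_subsample (n b : ℕ) : Fintype.card (Subsample n b) = n.choose b := by
  have := Fintype.card_finset_len (α := Fin n) b
  rw [Fintype.card_fin] at this
  exact this

/-- Double counting: each coordinate lies in `(n-1).choose (b-1)` of the sets, a fraction `b/n` of
all of them. -/
theorem sum_subsample {n b : ℕ} (hb : 1 ≤ b) (hbn : b ≤ n) (F : Fin n → ℝ) :
    ∑ S : Subsample n b, ∑ i ∈ S.1, F i =
      (Fintype.card (Subsample n b) : ℝ) * (b / n * ∑ i, F i) := by
  have h1 : ∑ S : Subsample n b, ∑ i ∈ S.1, F i =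
      ∑ S ∈ Finset.powersetCard b (Finset.univ : Finset (Fin n)), ∑ i ∈ S, F i := by
    symm
    exact Finset.sum_subtype (p := fun S : Finset (Fin n) => S.card = b)
      (Finset.powersetCard b (Finset.univ : Finset (Fin n))) (fun S => by simp)
      (fun S => ∑ i ∈ S, F i)
  have h2 : ∀ S : Finset (Fin n), ∑ i ∈ S, F i = ∑ i, if {i} ⊆ S then F i else 0 := by
    intro S
    simp
  have h3 : ∀ i : Fin n, ((Finset.powersetCard b (Finset.univ : Finset (Fin n))).filter
      ({i} ⊆ ·)).card = (n - 1).choose (b - 1) := by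
    intro i
    rw [Finset.card_filter_powersetCard_subset _ _ _ (Finset.subset_univ _) (by simpa using hb)]
    simp
  have h4 : (n : ℝ) * ((n - 1).choose (b - 1) : ℝ) = (n.choose b : ℝ) * b := by
    obtain ⟨m, rfl⟩ : ∃ m, n = m + 1 := ⟨n - 1, by omega⟩
    obtain ⟨c, rfl⟩ : ∃ c, b = c + 1 := ⟨b - 1, by omega⟩
    have := Nat.add_one_mul_choose_eq m c
    simp only [Nat.add_sub_cancel]
    exact_mod_cast this
  have hn : (n : ℝ) ≠ 0 := by
    have : n ≠ 0 := by omega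
    exact_mod_cast this
  rw [h1, Finset.sum_congr rfl fun S _ => h2 S, Finset.sum_comm, card_subsample]
  have h5 : ∀ i : Fin n, ∑ S ∈ Finset.powersetCard b (Finset.univ : Finset (Fin n)),
      (if {i} ⊆ S then F i else 0) = ((n - 1).choose (b - 1) : ℝ) * F i := by
    intro i
    rw [← Finset.sum_filter, Finset.sum_const, h3, nsmul_eq_mul]
  rw [Finset.sum_congr rfl fun i _ => h5 i, ← Finset.mul_sum, ← mul_assoc]
  congr 1
  field_simp
  linarith

theorem integral_uniformOn_univ {α : Type*} [Fintype α] [Nonempty α] [MeasurableSpace α]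
    [DiscreteMeasurableSpace α] (F : α → ℝ) :
    ∫ a, F a ∂(uniformOn (Set.univ : Set α)) = (Fintype.card α : ℝ)⁻¹ * ∑ a, F a := by
  rw [integral_fintype Integrable.of_finite, Finset.mul_sum]
  refine Finset.sum_congr rfl fun a _ => ?_
  rw [measureReal_def, uniformOn_univ, smul_eq_mul]
  simp

namespace GainShapeScheme

variable {d : ℕ} {P : ℝ} (S : GainShapeScheme d P)

/-! ### Expectations over the public randomness -/

instance : IsProbabilityMeasure S.randLaw := by
  have : Nonempty (Subsample (padDim d) S.b) := nonempty_subsample S.b_le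
  unfold randLaw
  infer_instance

/-- Measurability on the public randomness jointly with another variable: it suffices to check
it for fixed signs and a fixed subsampled set. -/
theorem measurable_rand_prod {α β : Type*} [MeasurableSpace α] [MeasurableSpace β]
    {F : S.Rand × α → β}
    (hF : ∀ s A, Measurable fun q : (Fin S.b → unitInterval) × α => F ((s, A, q.1), q.2)) :
    Measurable F := by
  have h1 : Measurable fun w : (Fin (padDim d) → Bool) × (Subsample (padDim d) S.b ×
      ((Fin S.b → unitInterval) × α)) => F ((w.1, w.2.1, w.2.2.1), w.2.2.2) :=
    measurable_from_prod_countable_right fun s => measurable_from_prod_countable_right fun A => hF s A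
  have h2 : Measurable fun q : S.Rand × α => (q.1.1, q.1.2.1, q.1.2.2, q.2) := by fun_prop
  exact h1.comp h2

theorem measurable_rand {β : Type*} [MeasurableSpace β] {F : S.Rand → β}
    (hF : ∀ s A, Measurable fun v : Fin S.b → unitInterval => F (s, A, v)) : Measurable F :=
  measurable_from_prod_countable_right fun s => measurable_from_prod_countable_right fun A => hF s A

theorem sum_coord (s : Fin (padDim d) → Bool) (A : Subsample (padDim d) S.b)
    (v : Fin S.b → unitInterval) (G : Fin (padDim d) → ℝ) :
    ∑ a, G (S.coord (s, A, v) a) = ∑ i ∈ A.1, G i := by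
  conv_rhs => rw [← Finset.map_orderEmbOfFin_univ A.1 A.2]
  rw [Finset.sum_map]
  rfl

theorem coord_injective (u : S.Rand) : Function.Injective (S.coord u) :=
  (u.2.1.1.orderEmbOfFin u.2.1.2).injective

/-- For fixed signs, each coordinate is kept with probability `b/n`, and whichever slot it occupies,
its rounding variable is uniform. Only the average over the signs is left. -/
theorem integral_randLaw_sum (φ : (Fin (padDim d) → Bool) → Fin (padDim d) → unitInterval → ℝ)
    (hφ : ∀ s i, Measurable (φ s i)) {K : ℝ} (hK : ∀ s i v, |φ s i v| ≤ K) :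
    Integrable (fun u : S.Rand => ∑ a, φ u.1 (S.coord u a) (u.2.2 a)) S.randLaw ∧
    ∫ u, ∑ a, φ u.1 (S.coord u a) (u.2.2 a) ∂S.randLaw =
      (2 ^ padDim d)⁻¹ * ∑ s, ((S.b : ℝ) / padDim d * ∑ i, ∫ v, φ s i v) := by
  have : Nonempty (Subsample (padDim d) S.b) := nonempty_subsample S.b_le
  have hm : Measurable fun u : S.Rand => ∑ a, φ u.1 (S.coord u a) (u.2.2 a) :=
    S.measurable_rand fun s A => Finset.measurable_sum _ fun a _ =>
      (hφ s (S.coord (s, A, fun _ => 0) a)).comp (measurable_pi_apply a)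
  have hint : Integrable (fun u : S.Rand => ∑ a, φ u.1 (S.coord u a) (u.2.2 a)) S.randLaw := by
    refine Integrable.of_bound hm.aestronglyMeasurable (S.b * K) (ae_of_all _ fun u => ?_)
    calc _ ≤ ∑ a : Fin S.b, K := norm_sum_le_of_le _ fun a _ => hK _ _ _
      _ = _ := by simp
  have hi1 : ∀ s i, Integrable (φ s i) (volume : Measure unitInterval) := fun s i =>
    Integrable.of_bound (hφ s i).aestronglyMeasurable K (ae_of_all _ fun v => hK s i v)
  have hv : ∀ s A, ∫ v : Fin S.b → unitInterval, ∑ a, φ s (S.coord (s, A, v) a) (v a) =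
      ∑ i ∈ A.1, ∫ t, φ s i t := by
    intro s A
    rw [← S.sum_coord s A (fun _ => 0) fun i => ∫ t, φ s i t, integral_finsetSum]
    · refine Finset.sum_congr rfl fun a _ => ?_
      exact integral_comp_eval (μ := fun _ : Fin S.b => (volume : Measure unitInterval)) (i := a)
        (f := φ s (S.coord (s, A, fun _ => 0) a)) (hφ _ _).aestronglyMeasurable
    · intro a _
      exact integrable_comp_eval (μ := fun _ : Fin S.b => (volume : Measure unitInterval)) (i := a)
        (f := φ s (S.coord (s, A, fun _ => 0) a)) (hi1 _ _)
  refine ⟨hint, ?_⟩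
  unfold randLaw at hint ⊢
  rw [integral_prod _ hint, integral_uniformOn_univ]
  congr 1
  · simp
  · refine Finset.sum_congr rfl fun s _ => ?_
    have h2 : Integrable (fun w : Subsample (padDim d) S.b × (Fin S.b → unitInterval) =>
        ∑ a, φ s (S.coord (s, w) a) (w.2 a)) ((uniformOn Set.univ).prod volume) := by
      refine Integrable.of_bound (hm.comp measurable_prodMk_left).aestronglyMeasurable (S.b * K)
        (ae_of_all _ fun u => ?_)
      calc _ ≤ ∑ a : Fin S.b, K := norm_sum_le_of_le _ fun a _ => hK _ _ _
        _ = _ := by simp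
    rw [integral_prod _ h2, integral_uniformOn_univ, Finset.sum_congr rfl fun A _ => hv s A,
      sum_subsample S.one_le_b S.b_le, ← mul_assoc, inv_mul_cancel₀, one_mul]
    exact_mod_cast Fintype.card_ne_zero

/-! ### The decoded shape in the absence of a detection error -/

/-- The level to which the `i`-th rotated coordinate of `x` is rounded. -/
def rounded (x : E d) (s : Fin (padDim d) → Bool) (i : Fin (padDim d)) (v : unitInterval) : ℝ :=
  let y : ℝ := (rotation s).mulVec (pad (padDim d) x) i
  let M := endpoint (padDim d) (intervalIndex (padDim d) (hBits d) y)
  level M (2 ^ S.κ) (levelIndex M S.κ S.one_le_κ v y)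

theorem measurable_rounded (x : E d) (s : Fin (padDim d) → Bool) (i : Fin (padDim d)) :
    Measurable (S.rounded x s i) := by
  have h := (measurable_levelIndex
    (endpoint (padDim d) (intervalIndex (padDim d) (hBits d)
      ((rotation s).mulVec (pad (padDim d) x) i))) S.κ S.one_le_κ).comp
    (measurable_prodMk_right (y := (rotation s).mulVec (pad (padDim d) x) i))
  exact (measurable_of_countable fun l : Fin (2 ^ S.κ) => level _ (2 ^ S.κ) (l : ℕ)).comp h

theorem abs_rounded_le (x : E d) (s : Fin (padDim d) → Bool) (i : Fin (padDim d))
    (v : unitInterval) :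
    |S.rounded x s i v| ≤ endpoint (padDim d) (2 ^ hBits d - 1) := by
  refine (abs_level_le (endpoint_nonneg _ _) (Fin.is_lt _)
    (two_le_two_pow S.one_le_κ)).trans (endpoint_monotone _ ?_)
  have := (intervalIndex (padDim d) (hBits d) ((rotation s).mulVec (pad (padDim d) x) i)).2
  omega

/-- The decoded shape when the receiver detects the correct point of the constellation. -/
def quantizedShape (u : S.Rand) (x : E d) : E d :=
  unpad d (((padDim d : ℝ) / S.b) •
    ((rotation u.1)⁻¹).mulVec (S.dequantize u (S.quantize u x)))

theorem dequantize_dotProduct (u : S.Rand) (c : Fin (padDim d) → ℝ)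
    (q : Fin S.b → Fin (2 ^ hBits d) × Fin (2 ^ S.κ)) :
    c ⬝ᵥ S.dequantize u q =
      ∑ a, c (S.coord u a) * level (endpoint (padDim d) (q a).1) (2 ^ S.κ) (q a).2 := by
  simp only [dotProduct, dequantize, Finset.mul_sum]
  rw [Finset.sum_comm]
  refine Finset.sum_congr rfl fun a _ => ?_
  simp

theorem dequantize_coord (u : S.Rand) (q : Fin S.b → Fin (2 ^ hBits d) × Fin (2 ^ S.κ))
    (a : Fin S.b) :
    S.dequantize u q (S.coord u a) = level (endpoint (padDim d) (q a).1) (2 ^ S.κ) (q a).2 := by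
  rw [dequantize, Finset.sum_eq_single a]
  · simp
  · intro a' _ ha'
    rw [if_neg fun h => ha' (S.coord_injective u h)]
  · simp

theorem inner_quantizedShape (u : S.Rand) (w x : E d) :
    inner ℝ w (S.quantizedShape u x) = (padDim d : ℝ) / S.b *
      ∑ a, (rotation u.1).mulVec (pad (padDim d) w) (S.coord u a) *
        S.rounded x u.1 (S.coord u a) (u.2.2 a) := by
  rw [quantizedShape, inner_unpad (le_padDim d), dotProduct_smul, dotProduct_rotation_inv_mulVec,
    S.dequantize_dotProduct, smul_eq_mul]
  rfl

/-- Multiplication by `R⁻¹` preserves the norm, so the only loss is in dropping the padded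
coordinates. -/
theorem norm_quantizedShape_sq_le (u : S.Rand) (x : E d) :
    ‖S.quantizedShape u x‖ ^ 2 ≤ ((padDim d : ℝ) / S.b) ^ 2 *
      ∑ a, S.rounded x u.1 (S.coord u a) (u.2.2 a) ^ 2 := by
  refine (norm_unpad_sq_le (le_padDim d) _).trans (le_of_eq ?_)
  rw [smul_dotProduct, dotProduct_smul, rotation_inv_mulVec_dotProduct_self,
    S.dequantize_dotProduct]
  simp only [dequantize_coord, smul_eq_mul]
  rw [← mul_assoc, ← sq]
  congr 1
  exact Finset.sum_congr rfl fun a _ => (sq _).symm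

/-- The second-moment factor of the shape quantizer. -/
def momentFactor : ℝ :=
  (padDim d : ℝ) / S.b * (if S.κ = 1 then 6.3 else 1 + 6.3 / (2 ^ S.κ - 1) ^ 2)

/-- Unbiasedness, tested against a vector `w`. It already holds for each fixed sign pattern; `‖x‖ ≤
1` excludes overflow of the intervals. -/
theorem integral_inner_quantizedShape (w x : E d) (hx : ‖x‖ ≤ 1) :
    Integrable (fun u => inner ℝ w (S.quantizedShape u x)) S.randLaw ∧
      ∫ u, inner ℝ w (S.quantizedShape u x) ∂S.randLaw = inner ℝ w x := by
  have hn : (0 : ℝ) < padDim d := by exact_mod_cast padDim_pos d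
  have hb : (0 : ℝ) < S.b := by exact_mod_cast S.one_le_b
  let φ : (Fin (padDim d) → Bool) → Fin (padDim d) → unitInterval → ℝ := fun s i v =>
    (rotation s).mulVec (pad (padDim d) w) i * S.rounded x s i v
  obtain ⟨K, hK⟩ : ∃ K : ℝ, ∀ s i v, |φ s i v| ≤ K := by
    obtain ⟨K, hK⟩ := Finite.bddAbove_range fun q : (Fin (padDim d) → Bool) × Fin (padDim d) =>
      |(rotation q.1).mulVec (pad (padDim d) w) q.2|
    refine ⟨K * endpoint (padDim d) (2 ^ hBits d - 1), fun s i v => ?_⟩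
    have h1 : |(rotation s).mulVec (pad (padDim d) w) i| ≤ K := hK ⟨(s, i), rfl⟩
    rw [abs_mul]
    exact mul_le_mul h1 (S.abs_rounded_le x s i v) (abs_nonneg _) ((abs_nonneg _).trans h1)
  obtain ⟨h1, h2⟩ := S.integral_randLaw_sum φ
    (fun s i => (S.measurable_rounded x s i).const_mul _) hK
  simp only [S.inner_quantizedShape]
  refine ⟨h1.const_mul _, ?_⟩
  rw [integral_const_mul, h2]
  have h3 : ∀ s, ∑ i, ∫ v, φ s i v = inner ℝ w x := by
    intro s
    rw [← pad_dotProduct_pad (le_padDim d), ← rotation_mulVec_dotProduct s, dotProduct]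
    refine Finset.sum_congr rfl fun i _ => ?_
    simp only [φ]
    rw [integral_const_mul]
    congr 1
    exact integral_level (endpoint_pos (padDim_pos d) _) S.one_le_κ
      (abs_le_endpoint_intervalIndex (abs_rotation_mulVec_pad_le s x hx i))
  simp only [h3]
  simp
  field_simp

/-- Sampling keeps `b/n` of the energy, which the decoder multiplies by `(n/b)²`. Here the random
signs matter: the squared endpoints sum to at most `3 · 2.1 = 6.3` on average. -/
theorem integral_norm_quantizedShape_sq_le (he : hBits d ≤ 3) (x : E d) (hx : ‖x‖ ≤ 1) :
    ∫ u, ‖S.quantizedShape u x‖ ^ 2 ∂S.randLaw ≤ S.momentFactor := by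
  have hn : (0 : ℝ) < padDim d := by exact_mod_cast padDim_pos d
  have hb : (0 : ℝ) < S.b := by exact_mod_cast S.one_le_b
  let φ : (Fin (padDim d) → Bool) → Fin (padDim d) → unitInterval → ℝ := fun s i v =>
    S.rounded x s i v ^ 2
  have hK : ∀ s i v, |φ s i v| ≤ endpoint (padDim d) (2 ^ hBits d - 1) ^ 2 := by
    intro s i v
    simp only [φ, abs_pow]
    gcongr
    exact S.abs_rounded_le x s i v
  obtain ⟨h1, h2⟩ := S.integral_randLaw_sum φ (fun s i => (S.measurable_rounded x s i).pow_const _) hK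
  have h3 : ∀ s, ∑ i, ∫ v, φ s i v ≤ ∑ i, quantSq S.κ ((rotation s).mulVec (pad (padDim d) x) i)
      (3 / padDim d * tetra (intervalIndex (padDim d) (hBits d)
        ((rotation s).mulVec (pad (padDim d) x) i))) := by
    intro s
    refine Finset.sum_le_sum fun i _ => ?_
    rw [← endpoint_sq]
    exact integral_level_sq_le (endpoint_pos (padDim_pos d) _) S.one_le_κ
      (abs_le_endpoint_intervalIndex (abs_rotation_mulVec_pad_le s x hx i))
  have h4 := sum_tetra_intervalIndex_le he x hx
  have hx2 : ‖x‖ ^ 2 ≤ 1 := pow_le_one₀ (norm_nonneg _) hx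
  have h5 : ∑ s : Fin (padDim d) → Bool, ∑ i, quantSq S.κ ((rotation s).mulVec (pad (padDim d) x) i)
      (3 / padDim d * tetra (intervalIndex (padDim d) (hBits d)
        ((rotation s).mulVec (pad (padDim d) x) i))) ≤
      2 ^ padDim d * (if S.κ = 1 then 6.3 else 1 + 6.3 / (2 ^ S.κ - 1) ^ 2) := by
    have h6 : ∑ s : Fin (padDim d) → Bool, ∑ i, (3 / padDim d * tetra (intervalIndex (padDim d)
        (hBits d) ((rotation s).mulVec (pad (padDim d) x) i))) ≤ 2 ^ padDim d * 6.3 := by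
      simp only [← Finset.mul_sum]
      calc _ ≤ 3 / (padDim d : ℝ) * (2 ^ padDim d * (padDim d * 2.1)) := by gcongr
        _ = _ := by field_simp; norm_num
    unfold quantSq
    split_ifs with h
    · exact h6
    · simp only [Finset.sum_add_distrib, sum_rotation_mulVec_pad_sq, ← Finset.sum_div]
      rw [mul_add, mul_div_assoc', mul_one]
      gcongr
      simpa using mul_le_of_le_one_right (by positivity : (0 : ℝ) ≤ 2 ^ padDim d) hx2
  calc ∫ u, ‖S.quantizedShape u x‖ ^ 2 ∂S.randLaw
      ≤ ∫ u, ((padDim d : ℝ) / S.b) ^ 2 *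
          ∑ a, S.rounded x u.1 (S.coord u a) (u.2.2 a) ^ 2 ∂S.randLaw :=
        integral_mono_of_nonneg (ae_of_all _ fun u => by positivity) (h1.const_mul _)
          (ae_of_all _ fun u => S.norm_quantizedShape_sq_le u x)
    _ = ((padDim d : ℝ) / S.b) ^ 2 *
          ((2 ^ padDim d)⁻¹ * ∑ s, ((S.b : ℝ) / padDim d * ∑ i, ∫ v, φ s i v)) := by
        rw [integral_const_mul, h2]
    _ = (padDim d : ℝ) / S.b * ((2 ^ padDim d)⁻¹ * ∑ s, ∑ i, ∫ v, φ s i v) := by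
        rw [← Finset.mul_sum]
        field_simp
    _ ≤ (padDim d : ℝ) / S.b * ((2 ^ padDim d)⁻¹ *
          (2 ^ padDim d * (if S.κ = 1 then 6.3 else 1 + 6.3 / (2 ^ S.κ - 1) ^ 2))) := by
        gcongr
        exact (Finset.sum_le_sum fun s _ => h3 s).trans h5
    _ = _ := by
        rw [momentFactor, ← mul_assoc (2 ^ padDim d)⁻¹, inv_mul_cancel₀ (by positivity), one_mul]

end GainShapeScheme

/-! ### Signalling with the ASK constellation -/

theorem one_lt_two_pow_real {ρ : ℕ} (hρ : 1 ≤ ρ) : (1 : ℝ) < 2 ^ ρ :=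
  one_lt_pow₀ one_lt_two (by omega)

theorem askPoint_sq_le {P : ℝ} (hP : 0 < P) {ρ : ℕ} (hρ : 1 ≤ ρ) (p : Fin (2 ^ ρ)) :
    askPoint P ρ p ^ 2 ≤ P := by
  have h1 : (0 : ℝ) < 2 ^ ρ - 1 := sub_pos.2 (one_lt_two_pow_real hρ)
  have h2 : ((p : ℕ) : ℝ) ≤ 2 ^ ρ - 1 := by
    have : ((p : ℕ) : ℝ) + 1 ≤ 2 ^ ρ := by exact_mod_cast p.2
    linarith
  have h3 : ((p : ℕ) : ℝ) * (2 * √P) / (2 ^ ρ - 1) ≤ 2 * √P := by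
    rw [div_le_iff₀ h1]
    nlinarith [Real.sqrt_nonneg P]
  have h4 : 0 ≤ ((p : ℕ) : ℝ) * (2 * √P) / (2 ^ ρ - 1) := by positivity
  have h5 : |askPoint P ρ p| ≤ √P := by
    unfold askPoint
    rw [abs_le]
    constructor <;> linarith
  calc askPoint P ρ p ^ 2 = |askPoint P ρ p| ^ 2 := (sq_abs _).symm
    _ ≤ √P ^ 2 := by gcongr
    _ = P := Real.sq_sqrt hP.le

/-- Minimum-distance detection is correct if the noise is less than half the spacing. -/
theorem eq_of_askPoint_dist_lt {P : ℝ} (hP : 0 < P) {ρ : ℕ} (hρ : 1 ≤ ρ) {p q : Fin (2 ^ ρ)} {z : ℝ}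
    (hz : |z| < √P / (2 ^ ρ - 1))
    (hq : |askPoint P ρ p + z - askPoint P ρ q| ≤ |askPoint P ρ p + z - askPoint P ρ p|) :
    q = p := by
  have h1 : (0 : ℝ) < 2 ^ ρ - 1 := sub_pos.2 (one_lt_two_pow_real hρ)
  have hs : 0 < √P := Real.sqrt_pos.2 hP
  rw [add_sub_cancel_left] at hq
  -- Both points are within half a spacing of the received value, so they are less than one spacing
  -- apart and their indices agree.
  have h2 : |askPoint P ρ p - askPoint P ρ q| < 2 * (√P / (2 ^ ρ - 1)) := by
    have : askPoint P ρ p - askPoint P ρ q = (askPoint P ρ p + z - askPoint P ρ q) - z := by ring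
    rw [this]
    have := abs_sub (askPoint P ρ p + z - askPoint P ρ q) z
    linarith
  have h3 : askPoint P ρ p - askPoint P ρ q =
      (((p : ℕ) : ℝ) - (q : ℕ)) * (2 * (√P / (2 ^ ρ - 1))) := by
    unfold askPoint
    ring
  have h4 : (0 : ℝ) < 2 * (√P / (2 ^ ρ - 1)) := by positivity
  rw [h3, abs_mul, abs_of_pos h4] at h2
  have h5 : |((p : ℕ) : ℝ) - (q : ℕ)| < 1 := by
    by_contra! h
    nlinarith
  have h6 : |((p : ℕ) : ℤ) - (q : ℕ)| < 1 := by exact_mod_cast h5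
  rw [Int.abs_lt_one_iff] at h6
  ext
  omega

/-- Ties are broken by the least index, which makes the detector measurable; a `GainShapeScheme`
alone does not guarantee this, and the protocol needs it. -/
theorem exists_measurable_nearest {m : ℕ} [NeZero m] (a : Fin m → ℝ) :
    ∃ f : ℝ → Fin m, Measurable f ∧ ∀ y p, |y - a (f y)| ≤ |y - a p| := by
  have hex : ∀ y : ℝ, ∃ k : ℕ, ∀ q, |y - a (Fin.ofNat m k)| ≤ |y - a q| := by
    intro y
    obtain ⟨p, hp⟩ := Finite.exists_min fun q => |y - a q|
    exact ⟨p, by simpa using hp⟩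
  classical
  refine ⟨fun y => Fin.ofNat m (Nat.find (hex y)), ?_, fun y => Nat.find_spec (hex y)⟩
  refine (measurable_of_countable fun k : ℕ => Fin.ofNat m k).comp (measurable_find hex fun k => ?_)
  simp only [Set.ofPred_forall]
  exact MeasurableSet.iInter fun q => measurableSet_le (by fun_prop) (by fun_prop)

theorem exists_scheme (d : ℕ) (P : ℝ) {b κ : ℕ} (hb : 1 ≤ b) (hbn : b ≤ padDim d) (hκ : 1 ≤ κ) :
    ∃ S : GainShapeScheme d P, S.b = b ∧ S.κ = κ ∧ Measurable S.detect := by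
  obtain ⟨f, hf, hmin⟩ := exists_measurable_nearest (askPoint P (b * (hBits d + κ)))
  have ζ : (Fin b → Fin (2 ^ hBits d) × Fin (2 ^ κ)) ≃ Fin (2 ^ (b * (hBits d + κ))) := by
    refine Fintype.equivFinOfCardEq ?_
    simp only [Fintype.card_pi, Fintype.card_prod, Fintype.card_fin, Finset.prod_const,
      Finset.card_univ]
    rw [← pow_add, ← pow_mul, mul_comm]
  exact ⟨⟨b, hb, hbn, κ, hκ, ζ, f, hmin⟩, rfl, rfl, hf⟩

/-! ### Gaussian noise -/

instance (ℓ : ℕ) (σ : ℝ) : IsProbabilityMeasure (noise ℓ σ) := by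
  unfold noise
  infer_instance

/-- Chernoff's bound with parameter `δ / v` for each of the two tails. -/
theorem gaussianReal_abs_ge_le {v : ℝ≥0} (hv : v ≠ 0) {δ : ℝ} (hδ : 0 ≤ δ) :
    (gaussianReal 0 v).real {z | δ ≤ |z|} ≤ 2 * Real.exp (-(δ ^ 2 / (2 * v))) := by
  have hv0 : (0 : ℝ) < v := by positivity
  have key : ∀ X : ℝ → ℝ, (gaussianReal 0 v).map X = gaussianReal 0 v →
      Integrable (fun z => Real.exp (δ / v * X z)) (gaussianReal 0 v) →
      (gaussianReal 0 v).real {z | δ ≤ X z} ≤ Real.exp (-(δ ^ 2 / (2 * v))) := by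
    intro X hX hint
    refine (measure_ge_le_exp_mul_mgf δ (by positivity) hint).trans (le_of_eq ?_)
    rw [mgf_gaussianReal hX, ← Real.exp_add]
    congr 1
    field_simp
    ring
  have h1 := key id Measure.map_id (integrable_exp_mul_gaussianReal _)
  have h2 := key (fun z => -z) (by rw [gaussianReal_map_neg, neg_zero])
    (by simpa using integrable_exp_mul_gaussianReal (μ := 0) (v := v) (-(δ / v)))
  have hsub : {z : ℝ | δ ≤ |z|} ⊆ {z | δ ≤ id z} ∪ {z | δ ≤ -z} := by
    intro z (hz : δ ≤ |z|)
    exact le_abs.1 hz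
  calc _ ≤ (gaussianReal 0 v).real ({z | δ ≤ id z} ∪ {z | δ ≤ -z}) := measureReal_mono hsub
    _ ≤ _ := (measureReal_union_le _ _).trans (by linarith)

theorem coe_toNNReal_sq (σ : ℝ) : (((σ ^ 2).toNNReal : ℝ≥0) : ℝ) = σ ^ 2 :=
  Real.coe_toNNReal _ (sq_nonneg σ)

theorem noise_abs_ge_le {ℓ : ℕ} (i : Fin ℓ) {σ : ℝ} (hσ : 0 < σ) {δ : ℝ} (hδ : 0 ≤ δ) :
    (noise ℓ σ).real {z | δ ≤ |z i|} ≤ 2 * Real.exp (-(δ ^ 2 / (2 * σ ^ 2))) := by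
  have hv : (σ ^ 2).toNNReal ≠ 0 := by
    simp only [ne_eq, Real.toNNReal_eq_zero, not_le]; positivity
  have h := gaussianReal_abs_ge_le hv hδ
  rw [coe_toNNReal_sq] at h
  have hmp := measurePreserving_eval (fun _ : Fin ℓ => gaussianReal 0 (σ ^ 2).toNNReal) i
  have := hmp.measureReal_preimage (s := {z : ℝ | δ ≤ |z|})
    (measurableSet_le (by fun_prop) (by fun_prop)).nullMeasurableSet
  rw [← this] at h
  exact h

theorem integrable_noise_eval {ℓ : ℕ} (i : Fin ℓ) (σ : ℝ) :
    Integrable (fun z => z i) (noise ℓ σ) :=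
  integrable_comp_eval (μ := fun _ : Fin ℓ => gaussianReal 0 (σ ^ 2).toNNReal) (f := fun t => t)
    ((memLp_id_gaussianReal' 1 (by norm_num)).integrable le_rfl)

theorem integral_noise_eval {ℓ : ℕ} (i : Fin ℓ) (σ : ℝ) : ∫ z, z i ∂(noise ℓ σ) = 0 := by
  have := integral_comp_eval (μ := fun _ : Fin ℓ => gaussianReal 0 (σ ^ 2).toNNReal) (i := i)
    (f := fun t => t) (by fun_prop)
  rw [integral_id_gaussianReal] at this
  exact this

theorem integrable_noise_eval_sq {ℓ : ℕ} (i : Fin ℓ) (σ : ℝ) :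
    Integrable (fun z => z i ^ 2) (noise ℓ σ) :=
  integrable_comp_eval (μ := fun _ : Fin ℓ => gaussianReal 0 (σ ^ 2).toNNReal)
    (f := fun t => t ^ 2) ((memLp_id_gaussianReal' 2 (by norm_num)).integrable_sq)

theorem integral_noise_eval_sq {ℓ : ℕ} (i : Fin ℓ) (σ : ℝ) :
    ∫ z, z i ^ 2 ∂(noise ℓ σ) = σ ^ 2 := by
  have := integral_comp_eval (μ := fun _ : Fin ℓ => gaussianReal 0 (σ ^ 2).toNNReal) (i := i)
    (f := fun t => t ^ 2) (by fun_prop)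
  have h2 : ∫ t, t ^ 2 ∂(gaussianReal 0 (σ ^ 2).toNNReal) = σ ^ 2 := by
    have h3 := variance_fun_id_gaussianReal (μ := 0) (v := (σ ^ 2).toNNReal)
    rw [variance_eq_integral (by fun_prop), integral_id_gaussianReal, coe_toNNReal_sq] at h3
    simpa using h3
  rw [h2] at this
  exact this

/-! ### Measurability and power of the scheme -/

/-- The quantizer output for one rotated coordinate `y`. -/
def quantizeCoord (n e κ : ℕ) (hκ : 1 ≤ κ) (v : unitInterval) (y : ℝ) :
    Fin (2 ^ e) × Fin (2 ^ κ) :=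
  (intervalIndex n e y, levelIndex (endpoint n (intervalIndex n e y)) κ hκ v y)

theorem measurable_quantizeCoord (n e κ : ℕ) (hκ : 1 ≤ κ) :
    Measurable fun w : unitInterval × ℝ => quantizeCoord n e κ hκ w.1 w.2 := by
  have hj : Measurable fun w : unitInterval × ℝ => intervalIndex n e w.2 :=
    (measurable_intervalIndex _ _).comp measurable_snd
  have hl : Measurable fun w : Fin (2 ^ e) × (unitInterval × ℝ) =>
      levelIndex (endpoint n w.1) κ hκ w.2.1 w.2.2 :=
    measurable_from_prod_countable_right fun j => measurable_levelIndex (endpoint n j) κ hκ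
  have h2 := hl.comp (hj.prodMk measurable_id)
  exact hj.prodMk h2

namespace GainShapeScheme

variable {d : ℕ} {P : ℝ} (S : GainShapeScheme d P)

theorem one_le_bits : 1 ≤ S.bits := by
  unfold bits
  have h1 := S.one_le_b
  have h2 := S.one_le_κ
  nlinarith

theorem measurable_quantize :
    Measurable fun q : S.Rand × E d => S.quantize q.1 q.2 := by
  refine S.measurable_rand_prod fun s A => ?_
  refine measurable_pi_lambda _ fun a => ?_
  have h1 := measurable_quantizeCoord (padDim d) (hBits d) S.κ S.one_le_κ
  have h2 : Measurable fun q : (Fin S.b → unitInterval) × E d =>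
      (q.1 a, (rotation s).mulVec (pad (padDim d) q.2) (S.coord (s, A, q.1) a)) := by
    refine Measurable.prodMk ((measurable_pi_apply a).comp measurable_fst) ?_
    refine Continuous.measurable ?_
    exact (continuous_apply (A.1.orderEmbOfFin A.2 a)).comp
      (Continuous.matrix_mulVec continuous_const ((continuous_pad _).comp continuous_snd))
  have h3 := h1.comp h2
  exact h3

theorem measurable_enc (B : ℝ) : Measurable fun q : S.Rand × E d => S.enc B q.1 q.2 := by
  have hsh : Measurable fun q : S.Rand × E d => (q.1, ‖q.2‖⁻¹ • q.2) := by fun_prop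
  refine measurable_pi_lambda _ fun i => ?_
  fin_cases i
  · have h : Measurable fun q : Fin S.b → Fin (2 ^ hBits d) × Fin (2 ^ S.κ) =>
        askPoint P S.bits (S.ζ q) := measurable_of_countable _
    have h2 := h.comp (S.measurable_quantize.comp hsh)
    exact h2
  · change Measurable fun q : S.Rand × E d => √P / B * ‖q.2‖
    fun_prop

theorem measurable_dec (hdet : Measurable S.detect) (B : ℝ) :
    Measurable fun q : S.Rand × (Fin 2 → ℝ) => S.dec B q.1 q.2 := by
  have hg : Measurable fun q : S.Rand × (Fin 2 → ℝ) => B / √P * q.2 1 := by fun_prop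
  refine Measurable.smul hg ?_
  refine S.measurable_rand_prod fun s A => ?_
  have h1 : Measurable fun q : (Fin S.b → unitInterval) × (Fin 2 → ℝ) => S.detect (q.2 0) :=
    hdet.comp (by fun_prop)
  -- Decoding does not use the rounding variables, so `0` stands in for them.
  exact (measurable_of_countable fun p : Fin (2 ^ (S.b * (hBits d + S.κ))) =>
    unpad d (((padDim d : ℝ) / S.b) • ((rotation s)⁻¹).mulVec
      (S.dequantize (s, A, fun _ => 0) (S.ζ.symm p)))).comp h1

/-- Correct detection. -/
theorem dec_eq (hP : 0 < P) {B : ℝ} (hB : 0 < B) (u : S.Rand) (g : E d) (z : Fin 2 → ℝ)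
    (hz : |z 0| < √P / (2 ^ S.bits - 1)) :
    S.dec B u (S.enc B u g + z) =
      (‖g‖ + B / √P * z 1) • S.quantizedShape u (‖g‖⁻¹ • g) := by
  have hs : 0 < √P := Real.sqrt_pos.2 hP
  have h0 : (S.enc B u g + z) 0 =
      askPoint P S.bits (S.ζ (S.quantize u (‖g‖⁻¹ • g))) + z 0 := rfl
  have h1 : (S.enc B u g + z) 1 = √P / B * ‖g‖ + z 1 := rfl
  have hdet : S.detect ((S.enc B u g + z) 0) = S.ζ (S.quantize u (‖g‖⁻¹ • g)) := by
    rw [h0]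
    exact eq_of_askPoint_dist_lt hP S.one_le_bits hz (S.detect_min _ _)
  have hgain : B / √P * (S.enc B u g + z) 1 = ‖g‖ + B / √P * z 1 := by
    rw [h1]
    field_simp
  rw [dec, hgain, shapeDec, hdet, Equiv.symm_apply_apply]
  rfl

/-- The code of the gain-shape scheme. -/
def code (hP : 0 < P) {B : ℝ} (hB : 0 < B) : Code d 2 P B S.Rand S.randLaw where
  enc := S.enc B
  measurable_enc := S.measurable_enc B
  -- The ASK symbol has energy at most `P` pointwise and the scaled gain has energy at most `P` on
  -- average, together `2P`.
  power p hp hmom := by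
    have hpt : ∀ q : S.Rand × E d, ENNReal.ofReal (∑ i, S.enc B q.1 q.2 i ^ 2) ≤
        ENNReal.ofReal P + ENNReal.ofReal (P / B ^ 2) * ‖q.2‖ₑ ^ 2 := by
      intro q
      have h1 := askPoint_sq_le hP S.one_le_bits (S.ζ (S.quantize q.1 (‖q.2‖⁻¹ • q.2)))
      have h2 : ‖q.2‖ₑ ^ 2 = ENNReal.ofReal (‖q.2‖ ^ 2) := by
        rw [ENNReal.ofReal_pow (norm_nonneg _), ofReal_norm]
      rw [h2, ← ENNReal.ofReal_mul (by positivity), ← ENNReal.ofReal_add hP.le (by positivity)]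
      refine ENNReal.ofReal_le_ofReal ?_
      have h3 : (√P / B * ‖q.2‖) ^ 2 = P / B ^ 2 * ‖q.2‖ ^ 2 := by
        rw [mul_pow, div_pow, Real.sq_sqrt hP.le]
      rw [Fin.sum_univ_two, ← h3]
      exact add_le_add h1 le_rfl
    calc _ ≤ ∫⁻ q, (ENNReal.ofReal P + ENNReal.ofReal (P / B ^ 2) * ‖q.2‖ₑ ^ 2)
            ∂(S.randLaw.prod p) := lintegral_mono hpt
      _ = ENNReal.ofReal P + ENNReal.ofReal (P / B ^ 2) * ∫⁻ q : S.Rand × E d, ‖q.2‖ₑ ^ 2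
            ∂(S.randLaw.prod p) := by
          rw [lintegral_add_left measurable_const, lintegral_const, measure_univ, mul_one,
            lintegral_const_mul _ (by fun_prop)]
      _ = ENNReal.ofReal P + ENNReal.ofReal (P / B ^ 2) * ∫⁻ g, ‖g‖ₑ ^ 2 ∂p := by
          rw [lintegral_prod _ (by fun_prop)]
          simp
      _ ≤ ENNReal.ofReal P + ENNReal.ofReal (P / B ^ 2) * ENNReal.ofReal (B ^ 2) := by gcongr
      _ = _ := by
          rw [← ENNReal.ofReal_mul (by positivity), ← ENNReal.ofReal_add hP.le (by positivity)]
          congr 1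
          field_simp
          norm_num

end GainShapeScheme

/-! ### Euclidean projection -/

theorem IsProj.inner_le_zero {d : ℕ} {X : Set (E d)} (hX : Convex ℝ X) {y p : E d}
    (h : IsProj X y p) {x : E d} (hx : x ∈ X) : inner ℝ (y - p) (x - p) ≤ 0 := by
  have : Nonempty X := ⟨⟨p, h.1⟩⟩
  refine (norm_eq_iInf_iff_real_inner_le_zero hX h.1).1 (le_antisymm ?_ ?_) x hx
  · exact le_ciInf fun w => h.2 w w.2
  · exact ciInf_le ⟨0, by rintro _ ⟨w, rfl⟩; exact norm_nonneg _⟩ (⟨p, h.1⟩ : X)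

theorem IsProj.norm_sub_le {d : ℕ} {X : Set (E d)} (hX : Convex ℝ X) {y p : E d}
    (h : IsProj X y p) {x : E d} (hx : x ∈ X) : ‖p - x‖ ≤ ‖y - x‖ := by
  have h1 := h.inner_le_zero hX hx
  have h2 : ‖y - x‖ ^ 2 = ‖y - p‖ ^ 2 - 2 * inner ℝ (y - p) (x - p) + ‖x - p‖ ^ 2 := by
    rw [← norm_sub_sq_real]
    congr 2
    abel
  rw [norm_sub_rev p x]
  refine le_of_sq_le_sq ?_ (norm_nonneg _)
  nlinarith [sq_nonneg ‖y - p‖]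

/-- The obtuse-angle inequality at both projections makes the map nonexpansive. Continuity serves
the measurability of the iterates. -/
theorem exists_continuous_proj {d : ℕ} {X : Set (E d)} (hne : X.Nonempty) (hcl : IsClosed X)
    (hX : Convex ℝ X) : ∃ Γ : E d → E d, Continuous Γ ∧ ∀ y, IsProj X y (Γ y) := by
  have hex : ∀ y, ∃ p, IsProj X y p := by
    intro y
    obtain ⟨p, hp, heq⟩ := exists_norm_eq_iInf_of_complete_convex hne hcl.isComplete hX y
    refine ⟨p, hp, fun x hx => ?_⟩
    rw [heq]
    exact ciInf_le ⟨0, by rintro _ ⟨w, rfl⟩; exact norm_nonneg _⟩ (⟨x, hx⟩ : X)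
  choose Γ hΓ using hex
  refine ⟨Γ, LipschitzWith.continuous (K := 1) (LipschitzWith.of_dist_le_mul fun y z => ?_), hΓ⟩
  rw [dist_eq_norm, dist_eq_norm, NNReal.coe_one, one_mul]
  have h1 := (hΓ y).inner_le_zero hX (hΓ z).1
  have h2 := (hΓ z).inner_le_zero hX (hΓ y).1
  have h3 : ‖Γ y - Γ z‖ ^ 2 = inner ℝ (y - z) (Γ y - Γ z) + inner ℝ (y - Γ y) (Γ z - Γ y) +
      inner ℝ (z - Γ z) (Γ y - Γ z) := by
    rw [← real_inner_self_eq_norm_sq]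
    simp only [inner_sub_left, inner_sub_right]
    ring
  have h4 := real_inner_le_norm (y - z) (Γ y - Γ z)
  by_contra! hlt
  nlinarith [norm_nonneg (y - z)]

/-! ### First-order information -/

namespace IsOracle

variable {d : ℕ} {X : Set (E d)} {B : ℝ} {f : E d → ℝ} {O : Kernel (E d) (E d)}

theorem integrable_norm_sq (hO : IsOracle X B f O) {x : E d} (hx : x ∈ X) :
    Integrable (fun g => ‖g‖ ^ 2) (O x) := by
  refine ⟨by fun_prop, ?_⟩
  have h := hO.meanSquare x hx
  rw [hasFiniteIntegral_iff_enorm]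
  simp only [enorm_pow, enorm_norm]
  exact lt_of_le_of_lt h ENNReal.ofReal_lt_top

theorem integral_norm_sq_le (hO : IsOracle X B f O) {x : E d} (hx : x ∈ X) :
    ∫ g, ‖g‖ ^ 2 ∂(O x) ≤ B ^ 2 := by
  rw [integral_eq_lintegral_of_nonneg_ae (ae_of_all _ fun g => by positivity) (by fun_prop)]
  refine ENNReal.toReal_le_of_le_ofReal (sq_nonneg B) ?_
  refine le_trans (le_of_eq ?_) (hO.meanSquare x hx)
  congr 1
  funext g
  rw [ENNReal.ofReal_pow (norm_nonneg _), ofReal_norm]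

theorem integrable (hO : IsOracle X B f O) {x : E d} (hx : x ∈ X) :
    Integrable (fun g => g) (O x) := by
  have := hO.markov
  have h : MemLp (fun g : E d => g) 2 (O x) :=
    (memLp_two_iff_integrable_sq_norm (by fun_prop)).2 (hO.integrable_norm_sq hx)
  exact h.integrable one_le_two

/-- Integrate `2B‖g‖ ≤ ‖g‖² + B²`. -/
theorem norm_mean_le (hO : IsOracle X B f O) (hB : 0 < B) {x : E d} (hx : x ∈ X) :
    ‖∫ g, g ∂(O x)‖ ≤ B := by
  have := hO.markov
  have h1 := norm_integral_le_integral_norm (μ := O x) fun g : E d => g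
  have h2 : ∫ g, 2 * B * ‖g‖ ∂(O x) ≤ ∫ g, (‖g‖ ^ 2 + B ^ 2) ∂(O x) := by
    refine integral_mono ((hO.integrable hx).norm.const_mul _)
      ((hO.integrable_norm_sq hx).add (integrable_const _)) fun g => ?_
    change 2 * B * ‖g‖ ≤ ‖g‖ ^ 2 + B ^ 2
    nlinarith [sq_nonneg (‖g‖ - B)]
  rw [integral_const_mul, integral_add (hO.integrable_norm_sq hx) (integrable_const _)] at h2
  have h3 := hO.integral_norm_sq_le hx
  simp at h2
  nlinarith

/-- The linear upper bound for the optimality gap at `x`. -/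
theorem sub_le_inner (hO : IsOracle X B f O) {x y : E d} (hx : x ∈ X) (hy : y ∈ X) :
    f x - f y ≤ inner ℝ (∫ g, g ∂(O x)) (x - y) := by
  have h := hO.unbiased x hx y hy
  have : inner ℝ (∫ g, g ∂(O x)) (y - x) = -inner ℝ (∫ g, g ∂(O x)) (x - y) := by
    rw [← inner_neg_right, neg_sub]
  linarith

theorem sub_le_mul_norm (hO : IsOracle X B f O) (hB : 0 < B) {x y : E d} (hx : x ∈ X)
    (hy : y ∈ X) : f x - f y ≤ B * ‖x - y‖ :=
  (hO.sub_le_inner hx hy).trans ((real_inner_le_norm _ _).trans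
    (mul_le_mul_of_nonneg_right (hO.norm_mean_le hB hx) (norm_nonneg _)))

/-- Convexity alone does not give continuity on the boundary. Here every point of `X` has a
subgradient of norm at most `B`, so `f` is `B`-Lipschitz on the compact set `X`. -/
theorem exists_minimizer (hO : IsOracle X B f O) (hB : 0 < B) {D : ℝ} (hX : IsAdmissible D X) :
    ∃ xs ∈ X, (∀ x ∈ X, f xs ≤ f x) ∧ sInf (f '' X) = f xs := by
  have hbd : Bornology.IsBounded X :=
    Metric.isBounded_iff.2 ⟨D, fun x hx y hy => by rw [dist_eq_norm]; exact hX.diam_le x hx y hy⟩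
  have hcomp : IsCompact X := Metric.isCompact_of_isClosed_isBounded hX.isClosed hbd
  have hlip : LipschitzOnWith B.toNNReal f X := by
    refine LipschitzOnWith.of_dist_le_mul fun x hx y hy => ?_
    rw [Real.coe_toNNReal _ hB.le, Real.dist_eq, dist_eq_norm, abs_le]
    have h1 := hO.sub_le_mul_norm hB hx hy
    have h2 := hO.sub_le_mul_norm hB hy hx
    rw [norm_sub_rev] at h2
    constructor <;> linarith
  obtain ⟨xs, hxs, hmin⟩ := hcomp.exists_isMinOn hX.nonempty hlip.continuousOn
  have hmin' : ∀ x ∈ X, f xs ≤ f x := fun x hx => hmin hx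
  refine ⟨xs, hxs, hmin', IsLeast.csInf_eq ⟨⟨xs, hxs, rfl⟩, ?_⟩⟩
  rintro _ ⟨x, hx, rfl⟩
  exact hmin' x hx

end IsOracle

/-! ### Histories -/

theorem measurable_snoc {α : Type*} [MeasurableSpace α] (t : ℕ) :
    Measurable fun w : (Fin t → α) × α => (Fin.snoc w.1 w.2 : Fin (t + 1) → α) := by
  refine measurable_pi_lambda _ fun i => ?_
  induction i using Fin.lastCases with
  | last => simpa using measurable_snd
  | cast i =>
    simp only [Fin.snoc_castSucc]
    exact (measurable_pi_apply i).comp measurable_fst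

namespace Protocol

variable {d : ℕ} {X : Set (E d)} {ℓ T : ℕ} {P B : ℝ}
  {𝒰 : Type} [MeasurableSpace 𝒰] {ν : Measure 𝒰} (π : Protocol X ℓ T P B 𝒰 ν)

theorem measurable_channel :
    Measurable fun w : 𝒰 × E d × (Fin ℓ → ℝ) => (w.1, π.code.enc w.1 w.2.1 + w.2.2) := by
  have h := π.code.measurable_enc.comp
    (measurable_fst.prodMk (measurable_fst.comp measurable_snd) :
      Measurable fun w : 𝒰 × E d × (Fin ℓ → ℝ) => (w.1, w.2.1))
  exact measurable_fst.prodMk (h.add (measurable_snd.comp measurable_snd))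

theorem step_apply [IsProbabilityMeasure ν] (σ : ℝ) (O : Kernel (E d) (E d)) [IsMarkovKernel O]
    (t : ℕ) (h : Fin t → 𝒰 × (Fin ℓ → ℝ)) :
    π.step σ O t h = (ν.prod ((O (π.query t h)).prod (noise ℓ σ))).map
      fun w : 𝒰 × E d × (Fin ℓ → ℝ) => (w.1, π.code.enc w.1 w.2.1 + w.2.2) := by
  rw [step, Kernel.map_apply _ π.measurable_channel, Kernel.prod_apply, Kernel.prod_apply,
    Kernel.const_apply, Kernel.const_apply, Kernel.comap_apply]

instance [IsProbabilityMeasure ν] (σ : ℝ) (O : Kernel (E d) (E d)) [IsMarkovKernel O] (t : ℕ) :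
    IsMarkovKernel (π.step σ O t) := by
  unfold step
  exact Kernel.IsMarkovKernel.map _ π.measurable_channel

instance isProbabilityMeasure_law [IsProbabilityMeasure ν] (σ : ℝ) (O : Kernel (E d) (E d))
    [IsMarkovKernel O] (t : ℕ) : IsProbabilityMeasure (π.law σ O t) := by
  induction t with
  | zero => unfold law; infer_instance
  | succ t ih =>
    unfold law
    exact Measure.isProbabilityMeasure_map (measurable_snoc t).aemeasurable

theorem lintegral_law_succ [IsProbabilityMeasure ν] (σ : ℝ) (O : Kernel (E d) (E d))
    [IsMarkovKernel O] (t : ℕ) {F : (Fin (t + 1) → 𝒰 × (Fin ℓ → ℝ)) → ℝ≥0∞} (hF : Measurable F) :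
    ∫⁻ h, F h ∂(π.law σ O (t + 1)) = ∫⁻ h, ∫⁻ w, F (Fin.snoc h w) ∂(π.step σ O t h)
      ∂(π.law σ O t) := by
  rw [law, lintegral_map hF (measurable_snoc t)]
  exact Measure.lintegral_compProd (hF.comp (measurable_snoc t))

/-- Trivial bound for the error of any protocol. -/
theorem error_le_mul [IsProbabilityMeasure ν] {D : ℝ} (hX : IsAdmissible D X)
    (hB : 0 < B) (σ : ℝ) {f : E d → ℝ} {O : Kernel (E d) (E d)} (hO : IsOracle X B f O) :
    π.error σ f O ≤ ENNReal.ofReal (D * B) := by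
  have := hO.markov
  obtain ⟨xs, hxs, _, hinf⟩ := hO.exists_minimizer hB hX
  unfold error
  calc _ ≤ ∫⁻ _, ENNReal.ofReal (D * B) ∂(π.law σ O T) := by
        refine lintegral_mono fun h => ENNReal.ofReal_le_ofReal ?_
        rw [hinf, mul_comm]
        exact (hO.sub_le_mul_norm hB (π.output_mem h) hxs).trans
          (mul_le_mul_of_nonneg_left (hX.diam_le _ (π.output_mem h) _ hxs) hB.le)
    _ = _ := by simp

/-- Convergence of the averaged iterates from a drift inequality for the squared distance to the
minimizer. -/
theorem error_le_of_drift [IsProbabilityMeasure ν] {D : ℝ} (hX : IsAdmissible D X) (hD : 0 < D)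
    (hB : 0 < B) (hT : 0 < T) (σ : ℝ) {f : E d → ℝ} {O : Kernel (E d) (E d)}
    (hO : IsOracle X B f O) {η c : ℝ} (hη : 0 < η) (hc : 0 ≤ c)
    (havg : ∀ h : Fin T → 𝒰 × (Fin ℓ → ℝ),
      π.output h = (T : ℝ)⁻¹ • ∑ t : Fin T, π.query t (fun s => h (s.castLE t.isLt.le)))
    (hdrift : ∀ xs ∈ X, ∀ t h, 0 ≤ inner ℝ (∫ g, g ∂(O (π.query t h))) (π.query t h - xs) →
      ∫⁻ w, ENNReal.ofReal (‖π.query (t + 1) (Fin.snoc h w) - xs‖ ^ 2)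
        ∂(π.step σ O t h) +
      ENNReal.ofReal (2 * η * inner ℝ (∫ g, g ∂(O (π.query t h))) (π.query t h - xs)) ≤
      ENNReal.ofReal (‖π.query t h - xs‖ ^ 2) + ENNReal.ofReal c) :
    π.error σ f O ≤ ENNReal.ofReal ((D ^ 2 + T * c) / (2 * η * T)) := by
  have := hO.markov
  obtain ⟨xs, hxs, hmin, hinf⟩ := hO.exists_minimizer hB hX
  -- The linear bound replaces the gap `f x - f xs`: it is measurable through the kernel, whereas
  -- `f` is arbitrary outside `X`.
  let G : E d → ℝ≥0∞ := fun x => ENNReal.ofReal (2 * η * inner ℝ (∫ g, g ∂(O x)) (x - xs))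
  have hG : Measurable G := by
    have h1 : Measurable fun x => ∫ g, g ∂(O x) :=
      (StronglyMeasurable.integral_kernel_prod_right (κ := O)
        (f := fun (_ : E d) (g : E d) => g) measurable_snd.stronglyMeasurable).measurable
    exact ((h1.inner (measurable_id.sub_const xs)).const_mul _).ennreal_ofReal
  let past : (t : ℕ) → (Fin t → 𝒰 × (Fin ℓ → ℝ)) → ℝ≥0∞ := fun t h =>
    ∑ s : Fin t, G (π.query s (fun s' => h (s'.castLE s.isLt.le)))
  have hpast : ∀ t, Measurable (past t) := fun t =>
    Finset.measurable_sum _ fun s _ => hG.comp ((π.measurable_query s).comp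
      (measurable_pi_lambda _ fun s' => measurable_pi_apply _))
  -- Potential: squared distance plus the gaps collected so far. By the drift inequality its mean
  -- grows by at most `c` per step.
  let W : (t : ℕ) → (Fin t → 𝒰 × (Fin ℓ → ℝ)) → ℝ≥0∞ := fun t h =>
    ENNReal.ofReal (‖π.query t h - xs‖ ^ 2) + past t h
  have hV : ∀ t, Measurable fun h => ENNReal.ofReal (‖π.query t h - xs‖ ^ 2) := fun t =>
    (((π.measurable_query t).sub_const xs).norm.pow_const 2).ennreal_ofReal
  have hW : ∀ t, Measurable (W t) := fun t => (hV t).add (hpast t)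
  have hsucc : ∀ t h w, past (t + 1) (Fin.snoc h w) = past t h + G (π.query t h) := by
    intro t h w
    simp only [past]
    rw [Fin.sum_univ_castSucc]
    congr 1
    · refine Finset.sum_congr rfl fun s _ => ?_
      congr 2
      funext s'
      exact Fin.snoc_castSucc (α := fun _ => 𝒰 × (Fin ℓ → ℝ)) w h (s'.castLE s.isLt.le)
    · congr 2
      funext s'
      exact Fin.snoc_castSucc (α := fun _ => 𝒰 × (Fin ℓ → ℝ)) w h s'
  have hind : ∀ t : ℕ, ∫⁻ h, W t h ∂(π.law σ O t) ≤
      ENNReal.ofReal (D ^ 2) + t * ENNReal.ofReal c := by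
    intro t
    induction t with
    | zero =>
      calc ∫⁻ h, W 0 h ∂(π.law σ O 0) ≤ ∫⁻ _, ENNReal.ofReal (D ^ 2) ∂(π.law σ O 0) := by
            refine lintegral_mono fun h => ?_
            simp only [W, past, Finset.univ_eq_empty, Finset.sum_empty, add_zero]
            refine ENNReal.ofReal_le_ofReal ?_
            have := hX.diam_le _ (π.query_mem 0 h) _ hxs
            gcongr
        _ = _ := by simp
    | succ t ih =>
      rw [π.lintegral_law_succ σ O t (hW (t + 1))]
      calc _ ≤ ∫⁻ h, (W t h + ENNReal.ofReal c) ∂(π.law σ O t) := by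
            refine lintegral_mono fun h => ?_
            simp only [W, hsucc]
            rw [lintegral_add_right _ measurable_const, lintegral_const, measure_univ, mul_one]
            have hgap : 0 ≤ inner ℝ (∫ g, g ∂(O (π.query t h))) (π.query t h - xs) := by
              have h1 := hO.sub_le_inner (π.query_mem t h) hxs
              have h2 := hmin _ (π.query_mem t h)
              linarith
            have := hdrift xs hxs t h hgap
            calc _ = (∫⁻ w, ENNReal.ofReal (‖π.query (t + 1) (Fin.snoc h w) - xs‖ ^ 2)
                    ∂(π.step σ O t h) + G (π.query t h)) + past t h := by ring
              _ ≤ (ENNReal.ofReal (‖π.query t h - xs‖ ^ 2) + ENNReal.ofReal c) + past t h := by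
                  gcongr
              _ = _ := by ring
        _ = ∫⁻ h, W t h ∂(π.law σ O t) + ENNReal.ofReal c := by
            rw [lintegral_add_right _ measurable_const, lintegral_const, measure_univ, mul_one]
        _ ≤ _ := by
            push_cast
            rw [add_mul, one_mul, ← add_assoc]
            gcongr
  have hTpos : (0 : ℝ) < T := by exact_mod_cast hT
  have hpt : ∀ h, ENNReal.ofReal (f (π.output h) - sInf (f '' X)) ≤
      ENNReal.ofReal (1 / (2 * η * T)) * W T h := by
    intro h
    let x : Fin T → E d := fun t => π.query t (fun s => h (s.castLE t.isLt.le))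
    have hx : ∀ t, x t ∈ X := fun t => π.query_mem _ _
    have hgap : ∀ t, 0 ≤ 2 * η * inner ℝ (∫ g, g ∂(O (x t))) (x t - xs) := by
      intro t
      have h1 := hO.sub_le_inner (hx t) hxs
      have h2 := hmin _ (hx t)
      exact mul_nonneg (by positivity) (by linarith)
    have hj : f (π.output h) ≤ ∑ t : Fin T, (T : ℝ)⁻¹ * f (x t) := by
      rw [havg h, Finset.smul_sum]
      refine hO.convexOn.map_sum_le (fun t _ => by positivity) ?_ fun t _ => hx t
      simp [hTpos.ne']
    have h1 : f (π.output h) - sInf (f '' X) ≤ 1 / (2 * η * T) *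
        ∑ t : Fin T, 2 * η * inner ℝ (∫ g, g ∂(O (x t))) (x t - xs) := by
      rw [hinf]
      have h2 : f xs = ∑ t : Fin T, (T : ℝ)⁻¹ * f xs := by
        simp [hTpos.ne']
      calc f (π.output h) - f xs ≤ ∑ t : Fin T, (T : ℝ)⁻¹ * (f (x t) - f xs) := by
            simp only [mul_sub, Finset.sum_sub_distrib]
            linarith
        _ ≤ ∑ t : Fin T, (T : ℝ)⁻¹ * inner ℝ (∫ g, g ∂(O (x t))) (x t - xs) := by
            gcongr with t
            exact hO.sub_le_inner (hx t) hxs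
        _ = _ := by
            rw [Finset.mul_sum]
            refine Finset.sum_congr rfl fun t _ => ?_
            field_simp
    calc _ ≤ ENNReal.ofReal (1 / (2 * η * T) *
          ∑ t : Fin T, 2 * η * inner ℝ (∫ g, g ∂(O (x t))) (x t - xs)) :=
          ENNReal.ofReal_le_ofReal h1
      _ = ENNReal.ofReal (1 / (2 * η * T)) * past T h := by
          rw [ENNReal.ofReal_mul (by positivity), ENNReal.ofReal_sum_of_nonneg fun t _ => hgap t]
      _ ≤ _ := by
          gcongr
          exact le_add_self
  unfold error
  calc _ ≤ ∫⁻ h, ENNReal.ofReal (1 / (2 * η * T)) * W T h ∂(π.law σ O T) := lintegral_mono hpt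
    _ = ENNReal.ofReal (1 / (2 * η * T)) * ∫⁻ h, W T h ∂(π.law σ O T) :=
        lintegral_const_mul _ (hW T)
    _ ≤ ENNReal.ofReal (1 / (2 * η * T)) * (ENNReal.ofReal (D ^ 2) + T * ENNReal.ofReal c) := by
        gcongr
        exact hind T
    _ = _ := by
        rw [← ENNReal.ofReal_natCast T, ← ENNReal.ofReal_mul hTpos.le,
          ← ENNReal.ofReal_add (by positivity) (by positivity), ← ENNReal.ofReal_mul (by positivity)]
        congr 1
        ring

end Protocol

/-! ### Projected subgradient descent as a protocol -/

/-- The iterates of projected subgradient descent as functions of the history. -/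
def psgdQuery {d : ℕ} {β : Type*} (Γ : E d → E d) (ψ : β → E d) (η : ℝ) (x₀ : E d) :
    (t : ℕ) → (Fin t → β) → E d
  | 0, _ => x₀
  | t + 1, h => Γ (psgdQuery Γ ψ η x₀ t (fun s => h s.castSucc) - η • ψ (h (Fin.last t)))

theorem measurable_psgdQuery {d : ℕ} {β : Type*} [MeasurableSpace β] {Γ : E d → E d} {ψ : β → E d}
    (hΓ : Measurable Γ) (hψ : Measurable ψ) (η : ℝ) (x₀ : E d) (t : ℕ) :
    Measurable (psgdQuery Γ ψ η x₀ t) := by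
  induction t with
  | zero => exact measurable_const
  | succ t ih =>
    refine hΓ.comp (Measurable.sub ?_ (Measurable.const_smul ?_ η))
    · exact ih.comp (measurable_pi_lambda _ fun s => measurable_pi_apply _)
    · exact hψ.comp (measurable_pi_apply _)

theorem psgdQuery_mem {d : ℕ} {β : Type*} {X : Set (E d)} {Γ : E d → E d} (ψ : β → E d)
    (hΓ : ∀ y, Γ y ∈ X) (η : ℝ) {x₀ : E d} (hx₀ : x₀ ∈ X) (t : ℕ) (h : Fin t → β) :
    psgdQuery Γ ψ η x₀ t h ∈ X := by
  cases t with
  | zero => exact hx₀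
  | succ t => exact hΓ _

theorem exists_psgd_protocol {d ℓ T : ℕ} {D P B : ℝ} {X : Set (E d)} (hX : IsAdmissible D X)
    {𝒰 : Type} [MeasurableSpace 𝒰] {ν : Measure 𝒰} (c : Code d ℓ P B 𝒰 ν)
    (ψ : 𝒰 → (Fin ℓ → ℝ) → E d) (hψ : Measurable fun q : 𝒰 × (Fin ℓ → ℝ) => ψ q.1 q.2)
    (hT : 0 < T) (η : ℝ) {x₀ : E d} (hx₀ : x₀ ∈ X) :
    ∃ π : Protocol X ℓ T P B 𝒰 ν, π.code = c ∧ π.IsPSGD ψ η x₀ := by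
  obtain ⟨Γ, hΓc, hΓ⟩ := exists_continuous_proj hX.nonempty hX.isClosed hX.convex
  let ψ' : 𝒰 × (Fin ℓ → ℝ) → E d := fun q => ψ q.1 q.2
  have hmeas := measurable_psgdQuery hΓc.measurable hψ η x₀
  have hmem : ∀ t h, psgdQuery Γ ψ' η x₀ t h ∈ X := psgdQuery_mem ψ' (fun y => (hΓ y).1) η hx₀
  have hTpos : (0 : ℝ) < T := by exact_mod_cast hT
  refine ⟨{ code := c
            query := psgdQuery Γ ψ' η x₀
            measurable_query := hmeas
            query_mem := hmem
            output := fun h => (T : ℝ)⁻¹ • ∑ t : Fin T,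
              psgdQuery Γ ψ' η x₀ t (fun s => h (s.castLE t.isLt.le))
            measurable_output := ?_
            output_mem := ?_ }, rfl, ⟨fun h => rfl, fun t h => hΓ _, fun h => rfl⟩⟩
  · have : Measurable fun h : Fin T → 𝒰 × (Fin ℓ → ℝ) => ∑ t : Fin T,
        psgdQuery Γ ψ' η x₀ t (fun s => h (s.castLE t.isLt.le)) := by
      refine Finset.measurable_sum _ fun t _ => ?_
      exact (hmeas t).comp (measurable_pi_lambda _ fun s => measurable_pi_apply _)
    exact this.const_smul (T : ℝ)⁻¹
  · intro h
    rw [Finset.smul_sum]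
    refine hX.convex.sum_mem (fun t _ => by positivity) ?_ fun t _ => hmem _ _
    simp [hTpos.ne']

/-! ### Drift of the gain-shape scheme -/

namespace GainShapeScheme

variable {d : ℕ} {P : ℝ} (S : GainShapeScheme d P)

theorem measurable_quantizedShape (x : E d) : Measurable fun u => S.quantizedShape u x := by
  have hq := S.measurable_quantize.comp (measurable_prodMk_right (y := x))
  refine S.measurable_rand fun s A => ?_
  have h1 : Measurable fun q : Fin S.b → Fin (2 ^ hBits d) × Fin (2 ^ S.κ) =>
      unpad d (((padDim d : ℝ) / S.b) • ((rotation s)⁻¹).mulVec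
        (S.dequantize (s, A, fun _ => 0) q)) := measurable_of_countable _
  have h2 := hq.comp ((measurable_prodMk_left (x := s)).comp (measurable_prodMk_left (x := A)))
  have h3 := h1.comp h2
  exact h3

theorem integrable_norm_quantizedShape_sq (x : E d) :
    Integrable (fun u => ‖S.quantizedShape u x‖ ^ 2) S.randLaw := by
  refine Integrable.of_bound
    ((S.measurable_quantizedShape x).norm.pow_const 2).aestronglyMeasurable
    (((padDim d : ℝ) / S.b) ^ 2 * ∑ _a : Fin S.b, endpoint (padDim d) (2 ^ hBits d - 1) ^ 2)
    (ae_of_all _ fun u => ?_)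
  rw [Real.norm_of_nonneg (by positivity)]
  refine (S.norm_quantizedShape_sq_le u x).trans ?_
  gcongr ?_ * ∑ a, ?_ with a
  rw [← sq_abs]
  have := S.abs_rounded_le x u.1 (S.coord u a) (u.2.2 a)
  gcongr

theorem momentFactor_nonneg : 0 ≤ S.momentFactor := by
  unfold momentFactor
  split_ifs <;> positivity

theorem integral_norm_sub_smul_sq_le (he : hBits d ≤ 3) (x w : E d) (hx : ‖x‖ ≤ 1) (t : ℝ) :
    Integrable (fun u => ‖w - t • S.quantizedShape u x‖ ^ 2) S.randLaw ∧
    ∫ u, ‖w - t • S.quantizedShape u x‖ ^ 2 ∂S.randLaw ≤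
      ‖w‖ ^ 2 - 2 * t * inner ℝ w x + t ^ 2 * S.momentFactor := by
  obtain ⟨h1, h2⟩ := S.integral_inner_quantizedShape w x hx
  have h3 := S.integrable_norm_quantizedShape_sq x
  have h4 := S.integral_norm_quantizedShape_sq_le he x hx
  have hexp : ∀ u, ‖w - t • S.quantizedShape u x‖ ^ 2 =
      ‖w‖ ^ 2 - 2 * t * inner ℝ w (S.quantizedShape u x) + t ^ 2 * ‖S.quantizedShape u x‖ ^ 2 := by
    intro u
    rw [norm_sub_sq_real, inner_smul_right, norm_smul, mul_pow, Real.norm_eq_abs, sq_abs]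
    ring
  simp only [hexp]
  have i1 : Integrable (fun u => ‖w‖ ^ 2 - 2 * t * inner ℝ w (S.quantizedShape u x)) S.randLaw :=
    (integrable_const _).sub (h1.const_mul _)
  refine ⟨i1.add (h3.const_mul _), ?_⟩
  rw [integral_add i1 (h3.const_mul _), integral_sub (integrable_const _) (h1.const_mul _),
    integral_const_mul, integral_const_mul, h2, integral_const, probReal_univ, one_smul]
  gcongr

/-- The probability that the noise of the first channel use reaches half the spacing of the
constellation. -/
def outage (σ : ℝ) : ℝ := (noise 2 σ).real {z | √P / (2 ^ S.bits - 1) ≤ |z 0|}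

/-- The terms integrate separately, so independence of the two noise coordinates plays no role. -/
theorem integral_noise_quadratic (σ k₀ k₁ k₂ k₃ : ℝ) :
    Integrable (fun z : Fin 2 → ℝ => k₀ + k₁ * z 1 + k₂ * z 1 ^ 2 +
      k₃ * {z : Fin 2 → ℝ | √P / (2 ^ S.bits - 1) ≤ |z 0|}.indicator 1 z) (noise 2 σ) ∧
    ∫ z : Fin 2 → ℝ, (k₀ + k₁ * z 1 + k₂ * z 1 ^ 2 +
      k₃ * {z : Fin 2 → ℝ | √P / (2 ^ S.bits - 1) ≤ |z 0|}.indicator 1 z) ∂(noise 2 σ) =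
      k₀ + k₂ * σ ^ 2 + k₃ * S.outage σ := by
  have hset : MeasurableSet {z : Fin 2 → ℝ | √P / (2 ^ S.bits - 1) ≤ |z 0|} :=
    measurableSet_le (by fun_prop) (by fun_prop)
  have i1 := (integrable_noise_eval (1 : Fin 2) σ).const_mul k₁
  have i2 := (integrable_noise_eval_sq (1 : Fin 2) σ).const_mul k₂
  have i3 : Integrable ({z : Fin 2 → ℝ | √P / (2 ^ S.bits - 1) ≤ |z 0|}.indicator
      (1 : (Fin 2 → ℝ) → ℝ)) (noise 2 σ) := (integrable_const (1 : ℝ)).indicator hset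
  have i0 : Integrable (fun _ : Fin 2 → ℝ => k₀) (noise 2 σ) := integrable_const _
  refine ⟨((i0.add i1).add i2).add (i3.const_mul k₃), ?_⟩
  have i01 : Integrable (fun z : Fin 2 → ℝ => k₀ + k₁ * z 1) (noise 2 σ) := i0.add i1
  have i02 : Integrable (fun z : Fin 2 → ℝ => k₀ + k₁ * z 1 + k₂ * z 1 ^ 2) (noise 2 σ) :=
    i01.add i2
  rw [integral_add i02 (i3.const_mul k₃), integral_add i01 i2, integral_add i0 i1, integral_const_mul, integral_const_mul, integral_const_mul,
    integral_noise_eval, integral_noise_eval_sq, integral_indicator_one hset, integral_const,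
    probReal_univ, one_smul]
  simp [outage]

/-- One step of projected subgradient descent with the gain-shape scheme; `V` is the squared
distance of the next iterate to `xs`. -/
theorem integral_drift_le (he : hBits d ≤ 3) (hP : 0 < P) {B D σ η : ℝ} (hB : 0 < B)
    {X : Set (E d)} {f : E d → ℝ} {O : Kernel (E d) (E d)}
    (hO : IsOracle X B f O) {x xs : E d} (hx : x ∈ X)
    {V : S.Rand × (Fin 2 → ℝ) → ℝ} (hV : Measurable V) (hV0 : ∀ q, 0 ≤ V q)
    (hVD : ∀ q, V q ≤ D ^ 2) (hVdec : ∀ q, V q ≤ ‖x - η • S.dec B q.1 q.2 - xs‖ ^ 2) :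
    ∫ w : S.Rand × E d × (Fin 2 → ℝ), V (w.1, S.enc B w.1 w.2.1 + w.2.2)
      ∂(S.randLaw.prod ((O x).prod (noise 2 σ))) ≤
    ‖x - xs‖ ^ 2 - 2 * η * inner ℝ (∫ g, g ∂(O x)) (x - xs) +
      (η ^ 2 * (S.momentFactor * (B ^ 2 * (1 + σ ^ 2 / P))) + D ^ 2 * S.outage σ) := by
  have := hO.markov
  set A := S.momentFactor with hA
  have hA0 : 0 ≤ A := S.momentFactor_nonneg
  set w : E d := x - xs with hw
  let H : S.Rand × E d × (Fin 2 → ℝ) → ℝ := fun q => V (q.1, S.enc B q.1 q.2.1 + q.2.2)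
  have hHm : Measurable H := by
    have h1 : Measurable fun q : S.Rand × E d × (Fin 2 → ℝ) => (q.1, q.2.1) := by fun_prop
    have h2 := (S.measurable_enc B).comp h1
    have h3 : Measurable fun q : S.Rand × E d × (Fin 2 → ℝ) => q.2.2 := by fun_prop
    exact hV.comp (measurable_fst.prodMk (h2.add h3))
  have hHi : Integrable H (S.randLaw.prod ((O x).prod (noise 2 σ))) :=
    Integrable.of_bound hHm.aestronglyMeasurable (D ^ 2) (ae_of_all _ fun q => by
      rw [Real.norm_of_nonneg (hV0 _)]; exact hVD _)
  let bad : Set (Fin 2 → ℝ) := {z | √P / (2 ^ S.bits - 1) ≤ |z 0|}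
  let sh : E d → E d := fun g => ‖g‖⁻¹ • g
  have hsh : ∀ g, ‖sh g‖ ≤ 1 := by
    intro g
    simp only [sh, norm_smul, norm_inv, norm_norm]
    exact inv_mul_le_one
  have hshg : ∀ g, ‖g‖ * inner ℝ w (sh g) = inner ℝ w g := by
    intro g
    rw [← inner_smul_right]
    congr 1
    rcases eq_or_ne g 0 with rfl | hg
    · simp
    · simp only [sh, smul_smul]
      rw [mul_inv_cancel₀ (norm_ne_zero_iff.2 hg), one_smul]
  -- The public randomness is integrated first, with `g` and `z` fixed. The quadratic of the
  -- error-free decoder is kept for all `z`, and `D²` is added on the outage event, so no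
  -- conditioning spoils unbiasedness.
  have hstep1 : ∀ g z, ∫ u, H (u, g, z) ∂S.randLaw ≤
      (‖w‖ ^ 2 - 2 * η * inner ℝ w g + η ^ 2 * A * ‖g‖ ^ 2) +
      (2 * η ^ 2 * A * ‖g‖ * (B / √P) - 2 * η * (B / √P) * inner ℝ w (sh g)) * z 1 +
      η ^ 2 * A * (B / √P) ^ 2 * z 1 ^ 2 + D ^ 2 * bad.indicator 1 z := by
    intro g z
    set γ : ℝ := ‖g‖ + B / √P * z 1 with hγ
    obtain ⟨i1, i2⟩ := S.integral_norm_sub_smul_sq_le he (sh g) w (hsh g) (η * γ)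
    calc ∫ u, H (u, g, z) ∂S.randLaw
        ≤ ∫ u, (‖w - (η * γ) • S.quantizedShape u (sh g)‖ ^ 2 + D ^ 2 * bad.indicator 1 z)
            ∂S.randLaw := by
          refine integral_mono_of_nonneg (ae_of_all _ fun u => hV0 _)
            (i1.add (integrable_const _)) (ae_of_all _ fun u => ?_)
          by_cases hz : z ∈ bad
          · rw [Set.indicator_of_mem hz]
            have := hVD (u, S.enc B u g + z)
            simp only [H, Pi.one_apply, mul_one]
            nlinarith [sq_nonneg ‖w - (η * γ) • S.quantizedShape u (sh g)‖]
          · have hz' : |z 0| < √P / (2 ^ S.bits - 1) := not_le.1 hz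
            rw [Set.indicator_of_notMem hz, mul_zero]
            simp only [add_zero]
            refine (hVdec _).trans (le_of_eq ?_)
            simp only
            rw [S.dec_eq hP hB u g z hz', smul_smul, sub_right_comm]
      _ ≤ ‖w‖ ^ 2 - 2 * (η * γ) * inner ℝ w (sh g) + (η * γ) ^ 2 * A + D ^ 2 * bad.indicator 1 z := by
          rw [integral_add i1 (integrable_const _), integral_const, probReal_univ, one_smul]
          gcongr
      _ = _ := by
          rw [hγ, ← hshg g]
          ring
  have hstep2 : ∀ g, ∫ z, ∫ u, H (u, g, z) ∂S.randLaw ∂(noise 2 σ) ≤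
      ‖w‖ ^ 2 - 2 * η * inner ℝ w g + η ^ 2 * A * ‖g‖ ^ 2 +
        η ^ 2 * A * (B / √P) ^ 2 * σ ^ 2 + D ^ 2 * S.outage σ := by
    intro g
    obtain ⟨i1, i2⟩ := S.integral_noise_quadratic σ
      (‖w‖ ^ 2 - 2 * η * inner ℝ w g + η ^ 2 * A * ‖g‖ ^ 2)
      (2 * η ^ 2 * A * ‖g‖ * (B / √P) - 2 * η * (B / √P) * inner ℝ w (sh g))
      (η ^ 2 * A * (B / √P) ^ 2) (D ^ 2)
    rw [← i2]
    exact integral_mono_of_nonneg (ae_of_all _ fun z => integral_nonneg fun u => hV0 _) i1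
      (ae_of_all _ fun z => hstep1 g z)
  have hP2 : (B / √P) ^ 2 = B ^ 2 / P := by rw [div_pow, Real.sq_sqrt hP.le]
  have i1 : Integrable (fun g => inner ℝ w g) (O x) := (hO.integrable hx).const_inner w
  have i2 := hO.integrable_norm_sq hx
  have i3 : Integrable (fun g => ‖w‖ ^ 2 - 2 * η * inner ℝ w g) (O x) :=
    (integrable_const _).sub (i1.const_mul _)
  have i4 : Integrable (fun g => ‖w‖ ^ 2 - 2 * η * inner ℝ w g + η ^ 2 * A * ‖g‖ ^ 2) (O x) :=
    i3.add (i2.const_mul _)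
  have hmean : ∫ g, inner ℝ w g ∂(O x) = inner ℝ (∫ g, g ∂(O x)) w := by
    rw [integral_inner (hO.integrable hx), real_inner_comm]
  calc ∫ q, H q ∂(S.randLaw.prod ((O x).prod (noise 2 σ)))
      = ∫ y, ∫ u, H (u, y) ∂S.randLaw ∂((O x).prod (noise 2 σ)) := integral_prod_symm _ hHi
    _ = ∫ g, ∫ z, ∫ u, H (u, g, z) ∂S.randLaw ∂(noise 2 σ) ∂(O x) :=
        integral_prod _ hHi.integral_prod_right
    _ ≤ ∫ g, (‖w‖ ^ 2 - 2 * η * inner ℝ w g + η ^ 2 * A * ‖g‖ ^ 2 +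
        (η ^ 2 * A * (B / √P) ^ 2 * σ ^ 2 + D ^ 2 * S.outage σ)) ∂(O x) := by
        refine integral_mono_of_nonneg
          (ae_of_all _ fun g => integral_nonneg fun z => integral_nonneg fun u => hV0 _)
          (i4.add (integrable_const _)) (ae_of_all _ fun g => ?_)
        simp only [← add_assoc]
        exact hstep2 g
    _ = ‖w‖ ^ 2 - 2 * η * inner ℝ (∫ g, g ∂(O x)) w + η ^ 2 * A * ∫ g, ‖g‖ ^ 2 ∂(O x) +
        (η ^ 2 * A * (B / √P) ^ 2 * σ ^ 2 + D ^ 2 * S.outage σ) := by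
        rw [integral_add i4 (integrable_const _), integral_add i3 (i2.const_mul _),
          integral_sub (integrable_const _) (i1.const_mul _), integral_const_mul,
          integral_const_mul, hmean]
        simp
    _ ≤ ‖w‖ ^ 2 - 2 * η * inner ℝ (∫ g, g ∂(O x)) w + η ^ 2 * A * B ^ 2 +
        (η ^ 2 * A * (B / √P) ^ 2 * σ ^ 2 + D ^ 2 * S.outage σ) := by
        gcongr
        exact hO.integral_norm_sq_le hx
    _ = _ := by
        rw [hP2]
        ring

/-- Worst-case error of projected subgradient descent with the gain-shape scheme. -/
theorem worstError_le (he : hBits d ≤ 3) (hP : 0 < P) {B D σ η : ℝ} (hB : 0 < B) (hD : 0 < D)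
    (hη : 0 < η) {T : ℕ} (hT : 0 < T) {X : Set (E d)} (hX : IsAdmissible D X) {x₀ : E d}
    (π : Protocol X 2 T P B S.Rand S.randLaw) (hcode : π.code.enc = S.enc B)
    (hπ : π.IsPSGD (S.dec B) η x₀) :
    π.worstError σ ≤ ENNReal.ofReal ((D ^ 2 + T * (η ^ 2 * (S.momentFactor *
      (B ^ 2 * (1 + σ ^ 2 / P))) + D ^ 2 * S.outage σ)) / (2 * η * T)) := by
  refine iSup_le fun f => iSup_le fun O => iSup_le fun hO => ?_
  have := hO.markov
  have hA0 : 0 ≤ S.momentFactor := S.momentFactor_nonneg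
  have hout : 0 ≤ S.outage σ := measureReal_nonneg
  refine π.error_le_of_drift hX hD hB hT σ hO hη (by positivity) hπ.average ?_
  intro xs hxs t h hgap
  set x := π.query t h with hxdef
  have hx : x ∈ X := π.query_mem t h
  let V : S.Rand × (Fin 2 → ℝ) → ℝ := fun q => ‖π.query (t + 1) (Fin.snoc h q) - xs‖ ^ 2
  have hV : Measurable V := by
    have h1 : Measurable fun q : S.Rand × (Fin 2 → ℝ) =>
        (Fin.snoc h q : Fin (t + 1) → S.Rand × (Fin 2 → ℝ)) :=
      (measurable_snoc t).comp measurable_prodMk_left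
    exact ((((π.measurable_query (t + 1)).comp h1).sub_const xs).norm.pow_const 2)
  have hV0 : ∀ q, 0 ≤ V q := fun q => by positivity
  have hVD : ∀ q, V q ≤ D ^ 2 := by
    intro q
    have := hX.diam_le _ (π.query_mem (t + 1) (Fin.snoc h q)) _ hxs
    simp only [V]
    gcongr
  have hVdec : ∀ q, V q ≤ ‖x - η • S.dec B q.1 q.2 - xs‖ ^ 2 := by
    intro q
    have h1 := (hπ.step t (Fin.snoc h q)).norm_sub_le hX.convex hxs
    simp only [Fin.snoc_castSucc, Fin.snoc_last] at h1
    simp only [V]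
    gcongr
  have hdr := S.integral_drift_le he hP (σ := σ) hB hO hx hV hV0 hVD hVdec
  have hint : ∫ q, V q ∂(π.step σ O t h) = ∫ w : S.Rand × E d × (Fin 2 → ℝ),
      V (w.1, S.enc B w.1 w.2.1 + w.2.2) ∂(S.randLaw.prod ((O x).prod (noise 2 σ))) := by
    rw [π.step_apply, integral_map π.measurable_channel.aemeasurable hV.aestronglyMeasurable, hcode]
  have hVi : Integrable V (π.step σ O t h) :=
    Integrable.of_bound hV.aestronglyMeasurable (D ^ 2) (ae_of_all _ fun q => by
      rw [Real.norm_of_nonneg (hV0 _)]; exact hVD _)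
  have hI0 : 0 ≤ ∫ q, V q ∂(π.step σ O t h) := integral_nonneg hV0
  rw [← ofReal_integral_eq_lintegral_ofReal hVi (ae_of_all _ hV0),
    ← ENNReal.ofReal_add hI0 (by positivity), ← ENNReal.ofReal_add (by positivity) (by positivity)]
  refine ENNReal.ofReal_le_ofReal ?_
  rw [hint]
  linarith

end GainShapeScheme

/-! ### Choice of the parameters -/

theorem hBits_le_three {d : ℕ} (h : lnStar ((d : ℝ) / 3) ≤ 7) : hBits d ≤ 3 :=
  Nat.clog_le_of_le_pow (by omega)

/-- If the number of bits is at most `r - 2`, the outage probability is at most `2 / N²`. -/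
theorem GainShapeScheme.outage_le {d N : ℕ} {P σ r : ℝ} (S : GainShapeScheme d P) (hN : 2 ≤ N)
    (hP : 0 < P) (hσ : 0 < σ) (hr : r = Real.logb 2 (√(4 * (P / σ ^ 2) / Real.log N) + 1))
    (hbits : (S.bits : ℝ) + 2 ≤ r) : S.outage σ ≤ 2 / (N : ℝ) ^ 2 := by
  have hNpos : (0 : ℝ) < N := by positivity
  have hlog : 0 < Real.log N := Real.log_pos (by exact_mod_cast hN)
  set q : ℝ := √(4 * (P / σ ^ 2) / Real.log N) with hq
  have hq0 : 0 ≤ q := Real.sqrt_nonneg _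
  have h1 : (0 : ℝ) < 2 ^ S.bits - 1 := sub_pos.2 (one_lt_two_pow_real S.one_le_bits)
  -- The two spare bits give the factor `4`: half the spacing is then at least `2σ √(ln N)`, and the
  -- Gaussian tail is at most `2 exp (-2 ln N)`.
  have h2 : (4 : ℝ) * 2 ^ S.bits ≤ q + 1 := by
    have h3 : (2 : ℝ) ^ r = q + 1 := by
      rw [hr]
      exact Real.rpow_logb two_pos (by norm_num) (by positivity)
    calc (4 : ℝ) * 2 ^ S.bits = (2 : ℝ) ^ ((S.bits : ℝ) + 2) := by
          rw [Real.rpow_add two_pos, Real.rpow_natCast]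
          norm_num
          ring
      _ ≤ (2 : ℝ) ^ r := Real.rpow_le_rpow_of_exponent_le one_le_two hbits
      _ = _ := h3
  have h4 : 4 * (2 ^ S.bits - 1) ≤ q := by linarith
  have h5 : 16 * (2 ^ S.bits - 1) ^ 2 ≤ 4 * (P / σ ^ 2) / Real.log N := by
    rw [← Real.sq_sqrt (by positivity : 0 ≤ 4 * (P / σ ^ 2) / Real.log N), ← hq]
    nlinarith
  rw [le_div_iff₀ hlog] at h5
  refine (noise_abs_ge_le (0 : Fin 2) hσ (by positivity)).trans ?_
  have h6 : 2 * Real.log N ≤ (√P / (2 ^ S.bits - 1)) ^ 2 / (2 * σ ^ 2) := by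
    rw [div_pow, Real.sq_sqrt hP.le, div_div, le_div_iff₀ (by positivity)]
    have h7 : 4 * (P / σ ^ 2) * σ ^ 2 = 4 * P := by field_simp
    nlinarith [mul_le_mul_of_nonneg_right h5 (sq_nonneg σ)]
  have h8 : Real.exp (-((√P / (2 ^ S.bits - 1)) ^ 2 / (2 * σ ^ 2))) ≤ 1 / (N : ℝ) ^ 2 := by
    calc _ ≤ Real.exp (-(2 * Real.log N)) := Real.exp_le_exp.2 (by linarith)
      _ = 1 / (N : ℝ) ^ 2 := by
        rw [Real.exp_neg, two_mul, Real.exp_add, Real.exp_log hNpos, one_div, sq]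
  calc _ ≤ 2 * (1 / (N : ℝ) ^ 2) := by gcongr
    _ = _ := by ring

/-- The square root is at least `2⁶ - 1 = 63` and `ln N > 0.69`. This bounds the gain-noise factor
`1 + 1/SNR` by `1.002`. -/
theorem snr_ge {N : ℕ} {SNR r : ℝ} (hN : 2 ≤ N) (hSNR : 0 < SNR)
    (hr : r = Real.logb 2 (√(4 * SNR / Real.log N) + 1)) (hr6 : 6 ≤ r) : 500 ≤ SNR := by
  have hlog2 : 0.69 < Real.log N :=
    lt_of_lt_of_le (by linarith [Real.log_two_gt_d9])
      (Real.log_le_log two_pos (by exact_mod_cast hN))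
  have hlog : 0 < Real.log N := by linarith
  have h1 : (63 : ℝ) ≤ √(4 * SNR / Real.log N) := by
    have h2 : (2 : ℝ) ^ r = √(4 * SNR / Real.log N) + 1 := by
      rw [hr]
      exact Real.rpow_logb two_pos (by norm_num) (by positivity)
    have h3 : (2 : ℝ) ^ (6 : ℝ) ≤ (2 : ℝ) ^ r := Real.rpow_le_rpow_of_exponent_le one_le_two hr6
    norm_num at h3
    linarith
  have h4 : (63 : ℝ) ^ 2 ≤ 4 * SNR / Real.log N := by
    rw [← Real.sq_sqrt (by positivity : 0 ≤ 4 * SNR / Real.log N)]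
    gcongr
  rw [le_div_iff₀ hlog] at h4
  nlinarith

/-- The parameters of the scheme. -/
theorem exists_params {d N : ℕ} {P r lam s : ℝ} (hd : 1 ≤ d) (he : hBits d ≤ 3)
    (hr6 : 6 ≤ r) (hs0 : 0 ≤ s) (hs : s ≤ 1 / 500)
    (hlam : lam = (d : ℝ) / min (d : ℝ) (r / 48)) (hN : 4 * lam < N) :
    ∃ S : GainShapeScheme d P, Measurable S.detect ∧ (S.bits : ℝ) + 2 ≤ r ∧
      S.momentFactor * (1 + s) * ((N + 1) / (N - 1)) ≤ 2 * lam := by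
  have hdpos : (0 : ℝ) < d := by exact_mod_cast hd
  have hnd : (padDim d : ℝ) ≤ 2 * d := by exact_mod_cast padDim_le_two_mul hd
  have hn0 : (0 : ℝ) < padDim d := by exact_mod_cast padDim_pos d
  have he' : (hBits d : ℝ) ≤ 3 := by exact_mod_cast he
  have hm0 : 0 < min (d : ℝ) (r / 48) := lt_min hdpos (by linarith)
  have hlam1 : 1 ≤ lam := by
    rw [hlam, le_div_iff₀ hm0, one_mul]
    exact min_le_left _ _
  have hlamr : 48 * d / r ≤ lam := by
    calc 48 * d / r = d / (r / 48) := by field_simp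
      _ ≤ _ := by
        rw [hlam]
        gcongr
        exact min_le_right _ _
  -- The ratio decreases in `N`, so each case below needs only the lower bound on `N` that `4λ < N`
  -- supplies.
  have hratio : ∀ a : ℝ, 1 < a → a ≤ N → ((N : ℝ) + 1) / (N - 1) ≤ (a + 1) / (a - 1) := by
    intro a ha haN
    rw [div_le_div_iff₀ (by linarith) (by linarith)]
    nlinarith
  have hratio0 : (0 : ℝ) ≤ ((N : ℝ) + 1) / (N - 1) := div_nonneg (by positivity) (by linarith)
  -- For `r < 7` only one coordinate with two levels fits: `3 + 1 + 2 = 6` bits. Here `λ ≥ 48d/7`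
  -- forces `N ≥ 28`, and `12.6 · 1.002 · 29/27 < 96/7`.
  rcases lt_or_ge r 7 with h7 | h7
  · obtain ⟨S, hSb, hSκ, hdet⟩ := exists_scheme d P (le_refl 1) (padDim_pos d) (le_refl 1)
    refine ⟨S, hdet, ?_, ?_⟩
    · rw [GainShapeScheme.bits, hSb, hSκ]
      push_cast
      linarith
    · have h1 : 48 * d / 7 ≤ lam := le_trans (by gcongr) hlamr
      have h2 : (28 : ℝ) ≤ N := by
        have h3 : (27 : ℝ) < N := by
          have : (1 : ℝ) ≤ d := by exact_mod_cast hd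
          linarith
        exact_mod_cast (show 27 < N by exact_mod_cast h3)
      have h3 := hratio 28 (by norm_num) h2
      rw [GainShapeScheme.momentFactor, hSb, hSκ, if_pos rfl]
      calc (padDim d : ℝ) / (1 : ℕ) * 6.3 * (1 + s) * ((N + 1) / (N - 1))
          ≤ 2 * d / (1 : ℕ) * 6.3 * (1 + 1 / 500) * ((28 + 1) / (28 - 1)) := by gcongr
        _ ≤ 2 * (48 * d / 7) := by
          norm_num
          linarith
        _ ≤ _ := by linarith
  -- For `7 ≤ r < 14`, one coordinate with four levels uses at most five bits.
  rcases lt_or_ge r 14 with h14 | h14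
  · obtain ⟨S, hSb, hSκ, hdet⟩ := exists_scheme d P (le_refl 1) (padDim_pos d) one_le_two
    refine ⟨S, hdet, ?_, ?_⟩
    · rw [GainShapeScheme.bits, hSb, hSκ]
      push_cast
      linarith
    · have h1 : 48 * d / 14 ≤ lam := le_trans (by gcongr) hlamr
      have h2 : (13 : ℝ) ≤ N := by
        have : (1 : ℝ) ≤ d := by exact_mod_cast hd
        linarith
      have h3 := hratio 13 (by norm_num) h2
      rw [GainShapeScheme.momentFactor, hSb, hSκ, if_neg (by norm_num)]
      calc (padDim d : ℝ) / (1 : ℕ) * (1 + 6.3 / (2 ^ 2 - 1) ^ 2) * (1 + s) *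
            (((N : ℝ) + 1) / (N - 1))
          ≤ 2 * (d : ℝ) / (1 : ℕ) * (1 + 6.3 / (2 ^ 2 - 1) ^ 2) * (1 + 1 / 500) *
              ((13 + 1) / (13 - 1)) := by gcongr
        _ ≤ 2 * (48 * (d : ℝ) / 14) := by
          norm_num
          linarith
        _ ≤ _ := by linarith
  -- With eight levels each coordinate costs at most six bits, so `m` coordinates fit into `r - 2`
  -- bits.
  · set m : ℕ := ⌊(r - 2) / 6⌋₊ with hm
    have hm1 : (m : ℝ) ≤ (r - 2) / 6 := Nat.floor_le (by linarith)
    have hm2 : (r - 2) / 6 < m + 1 := Nat.lt_floor_add_one _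
    have hm3 : 1 ≤ m := Nat.le_floor (by push_cast; linarith)
    have hm3' : (1 : ℝ) ≤ m := by exact_mod_cast hm3
    obtain ⟨S, hSb, hSκ, hdet⟩ := exists_scheme d P (b := min (padDim d) m) (κ := 3)
      (le_min (padDim_pos d) hm3) (min_le_left _ _) (by norm_num)
    have h2 : (5 : ℝ) ≤ N := by
      have h3 : (4 : ℝ) < N := by linarith
      exact_mod_cast (show 4 < N by exact_mod_cast h3)
    have h3 := hratio 5 (by norm_num) h2
    -- Uses `n ≤ 2d` and `r ≤ 28 m`, valid for `r ≥ 14` despite the floor. The final product `7/6 ·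
    -- (1 + 6.3/49) · 1.002 · 3/2` is just below `2`.
    have hb : (padDim d : ℝ) / (min (padDim d) m : ℕ) ≤ 7 / 6 * lam := by
      rcases le_total (padDim d) m with h | h
      · rw [min_eq_left h, div_self hn0.ne']
        linarith
      · rw [min_eq_right h]
        refine le_trans ?_ (mul_le_mul_of_nonneg_left hlamr (by norm_num))
        rw [div_le_iff₀ (by linarith)]
        calc (padDim d : ℝ) ≤ 2 * d := hnd
          _ ≤ 7 / 6 * (48 * d / r) * m := by
            rw [mul_div_assoc', div_mul_eq_mul_div, le_div_iff₀ (by linarith)]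
            nlinarith
    refine ⟨S, hdet, ?_, ?_⟩
    · have h4 : ((min (padDim d) m : ℕ) : ℝ) ≤ m := by exact_mod_cast min_le_right _ _
      rw [GainShapeScheme.bits, hSb, hSκ]
      rw [Nat.cast_mul, Nat.cast_add]
      have h5 : ((min (padDim d) m : ℕ) : ℝ) * ((hBits d : ℝ) + (3 : ℕ)) ≤ m * 6 := by
        gcongr
        push_cast
        linarith
      linarith
    · rw [GainShapeScheme.momentFactor, hSb, hSκ, if_neg (by norm_num)]
      calc (padDim d : ℝ) / (min (padDim d) m : ℕ) * (1 + 6.3 / (2 ^ 3 - 1) ^ 2) * (1 + s) *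
            ((N + 1) / (N - 1))
          ≤ 7 / 6 * lam * (1 + 6.3 / (2 ^ 3 - 1) ^ 2) * (1 + 1 / 500) * ((5 + 1) / (5 - 1)) := by
            gcongr
        _ ≤ _ := by
          norm_num
          linarith

/-- The bound of the descent analysis with the step size `M / a` is at most the target `M`. -/
theorem psgd_bound_le {T : ℝ} {D p η a M κ : ℝ} (hT : 0 < T) (ha : 0 < a) (hM : 0 < M)
    (hη : η = M / a) (hp : 1 + T * p ≤ κ) (hκ : a * D ^ 2 * κ ≤ T * M ^ 2) :
    (D ^ 2 + T * (η ^ 2 * a + D ^ 2 * p)) / (2 * η * T) ≤ M := by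
  have hη0 : 0 < η := by rw [hη]; positivity
  rw [div_le_iff₀ (by positivity)]
  have h1 : D ^ 2 * κ ≤ T * M ^ 2 / a := by
    rw [le_div_iff₀ ha]
    linarith
  have h2 : D ^ 2 * (1 + T * p) ≤ D ^ 2 * κ := mul_le_mul_of_nonneg_left hp (sq_nonneg D)
  -- Half of this pays for the second-moment term, the other half for the initial distance and the
  -- outages.
  have h3 : M * (2 * η * T) = 2 * (T * M ^ 2 / a) := by
    rw [hη]
    field_simp
  have h4 : T * (η ^ 2 * a) = T * M ^ 2 / a := by
    rw [hη]
    field_simp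
  rw [h3]
  linarith

/-- Projected subgradient descent with a suitable gain-shape scheme attains the bound. -/
theorem exists_gainShape_psgd {d N : ℕ} (hd : 1 ≤ d) (hN : 2 ≤ N) {D B P σ r : ℝ}
    (hD : 0 < D) (hB : 0 < B) (hP : 0 < P) (hσ : 0 < σ)
    (hr : r = Real.logb 2 (√(4 * (P / σ ^ 2) / Real.log N) + 1))
    (hstar : lnStar ((d : ℝ) / 3) ≤ 7) (hr6 : 6 ≤ r) :
    ∃ (S : GainShapeScheme d P) (T : ℕ) (η : ℝ),
      (S.bits : ℝ) ≤ r ∧ 0 < T ∧ 2 * T ≤ N ∧ 0 < η ∧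
      ∀ X : Set (E d), IsAdmissible D X → ∀ x₀ ∈ X,
        ∃ π : Protocol X 2 T P B S.Rand S.randLaw,
          π.code.enc = S.enc B ∧ π.IsPSGD (S.dec B) η x₀ ∧
          π.worstError σ ≤
            ENNReal.ofReal (2 * D * B / √(N : ℝ) * √((d : ℝ) / min (d : ℝ) (r / 48))) := by
  have he := hBits_le_three hstar
  have hNpos : (0 : ℝ) < N := by positivity
  have hdpos : (0 : ℝ) < d := by exact_mod_cast hd
  set lam : ℝ := (d : ℝ) / min (d : ℝ) (r / 48) with hlam
  have hlam0 : 0 < lam := div_pos hdpos (lt_min hdpos (by linarith))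
  set M : ℝ := 2 * D * B / √(N : ℝ) * √lam with hM
  have hM0 : 0 < M := by positivity
  have hMsq : M ^ 2 = 4 * D ^ 2 * B ^ 2 * lam / N := by
    rw [hM, mul_pow, div_pow, Real.sq_sqrt hNpos.le, Real.sq_sqrt hlam0.le]
    ring
  -- If `N ≤ 4λ`, the target is at least `DB`, and any admissible parameters work.
  rcases le_or_gt (N : ℝ) (4 * lam) with hsmall | hlarge
  · obtain ⟨S, hSb, hSκ, hdet⟩ := exists_scheme d P (le_refl 1) (padDim_pos d) (le_refl 1)
    refine ⟨S, 1, 1, ?_, one_pos, by omega, one_pos, fun X hX x₀ hx₀ => ?_⟩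
    · have he' : (hBits d : ℝ) ≤ 3 := by exact_mod_cast he
      rw [GainShapeScheme.bits, hSb, hSκ]
      push_cast
      linarith
    · obtain ⟨π, hcode, hπ⟩ := exists_psgd_protocol hX (S.code hP hB) (S.dec B)
        (S.measurable_dec hdet B) one_pos 1 hx₀
      refine ⟨π, by rw [hcode]; rfl, hπ, ?_⟩
      refine iSup_le fun f => iSup_le fun O => iSup_le fun hO => ?_
      refine (π.error_le_mul hX hB σ hO).trans (ENNReal.ofReal_le_ofReal ?_)
      refine le_of_sq_le_sq ?_ hM0.le
      rw [hMsq, le_div_iff₀ hNpos]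
      calc (D * B) ^ 2 * N ≤ (D * B) ^ 2 * (4 * lam) := by gcongr
        _ = _ := by ring
  · have hSNR0 : 0 < P / σ ^ 2 := by positivity
    have hSNR := snr_ge hN hSNR0 hr hr6
    have hs : σ ^ 2 / P ≤ 1 / 500 := by
      rw [div_le_div_iff₀ hP (by norm_num)]
      rw [le_div_iff₀ (by positivity)] at hSNR
      linarith
    obtain ⟨S, hdet, hbits, hfac⟩ := exists_params (P := P) hd he hr6 (by positivity) hs hlam hlarge
    have hout := S.outage_le hN hP hσ hr hbits
    have hT1 : 0 < N / 2 := by omega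
    have hTpos : (0 : ℝ) < ((N / 2 : ℕ) : ℝ) := by exact_mod_cast hT1
    have hTle : (((N / 2 : ℕ) : ℝ)) ≤ N / 2 := Nat.cast_div_le
    -- An odd `N` wastes one channel use; this is the source of `N - 1` in the parameter condition.
    have hTge : ((N : ℝ) - 1) / 2 ≤ ((N / 2 : ℕ) : ℝ) := by
      have : N ≤ 2 * (N / 2) + 1 := by omega
      have : (N : ℝ) ≤ 2 * ((N / 2 : ℕ) : ℝ) + 1 := by exact_mod_cast this
      linarith
    have hN1 : (0 : ℝ) < N - 1 := by
      have : (2 : ℝ) ≤ N := by exact_mod_cast hN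
      linarith
    have hA : 0 < S.momentFactor := by
      have hb : (0 : ℝ) < S.b := by exact_mod_cast S.one_le_b
      have hn : (0 : ℝ) < padDim d := by exact_mod_cast padDim_pos d
      unfold GainShapeScheme.momentFactor
      split_ifs <;> positivity
    set a : ℝ := S.momentFactor * (B ^ 2 * (1 + σ ^ 2 / P)) with ha
    have ha0 : 0 < a := by positivity
    refine ⟨S, N / 2, M / a, by linarith, hT1, by omega, by positivity, fun X hX x₀ hx₀ => ?_⟩
    obtain ⟨π, hcode, hπ⟩ := exists_psgd_protocol hX (S.code hP hB) (S.dec B)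
      (S.measurable_dec hdet B) hT1 (M / a) hx₀
    have hcode' : π.code.enc = S.enc B := by rw [hcode]; rfl
    refine ⟨π, hcode', hπ, ?_⟩
    refine (S.worstError_le he hP hB hD (by positivity) hT1 hX π hcode' hπ).trans
      (ENNReal.ofReal_le_ofReal ?_)
    -- `1 + T p ≤ 1 + (N/2)(2/N²) = (N + 1)/N`.
    refine psgd_bound_le (κ := ((N : ℝ) + 1) / N) hTpos ha0 hM0 rfl ?_ ?_
    · have h1 : ((N / 2 : ℕ) : ℝ) * S.outage σ ≤ N / 2 * (2 / (N : ℝ) ^ 2) := by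
        gcongr
        exact measureReal_nonneg
      have h2 : (N : ℝ) / 2 * (2 / (N : ℝ) ^ 2) = 1 / N := by field_simp
      rw [add_div, div_self hNpos.ne']
      linarith
    · have h1 : S.momentFactor * (1 + σ ^ 2 / P) * (N + 1) ≤ 2 * lam * (N - 1) := by
        rw [mul_div_assoc', div_le_iff₀ hN1] at hfac
        exact hfac
      calc a * D ^ 2 * (((N : ℝ) + 1) / N)
          = D ^ 2 * B ^ 2 / N * (S.momentFactor * (1 + σ ^ 2 / P) * (N + 1)) := by
            rw [ha]
            ring
        _ ≤ D ^ 2 * B ^ 2 / N * (2 * lam * (N - 1)) := by gcongr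
        _ = ((N : ℝ) - 1) / 2 * M ^ 2 := by
            rw [hMsq]
            ring
        _ ≤ _ := by gcongr

end

end OverTheAir

open OverTheAir in
theorem theorem5 (d N : ℕ) (hd : 1 ≤ d) (hN : 2 ≤ N) (D B P σ SNR r : ℝ)
    (hD : 0 < D) (hB : 0 < B) (hP : 0 < P) (hσ : 0 < σ)
    (hSNR : SNR = P / σ ^ 2)
    (hr : r = Real.logb 2 (√(4 * SNR / Real.log N) + 1))
    (hstar : lnStar ((d : ℝ) / 3) ≤ 7) (hr6 : 6 ≤ r) :
    minmaxError d D B P σ N ≤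
        ENNReal.ofReal (2 * D * B / √(N : ℝ) * √((d : ℝ) / min (d : ℝ) (r / 48))) ∧
      ∃ (S : GainShapeScheme d P) (T : ℕ) (η : ℝ),
        (S.bits : ℝ) ≤ r ∧ 0 < T ∧ 2 * T ≤ N ∧ 0 < η ∧
        ∀ X : Set (E d), IsAdmissible D X → ∀ x₀ ∈ X,
          ∃ π : Protocol X 2 T P B S.Rand S.randLaw,
            π.code.enc = S.enc B ∧ π.IsPSGD (S.dec B) η x₀ ∧
            π.worstError σ ≤
              ENNReal.ofReal (2 * D * B / √(N : ℝ) * √((d : ℝ) / min (d : ℝ) (r / 48))) := by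
  subst hSNR
  have hmain := exists_gainShape_psgd hd hN hD hB hP hσ hr hstar hr6
  refine ⟨?_, hmain⟩
  obtain ⟨S, T, η, _, _, hTN, _, hS⟩ := hmain
  refine iSup_le fun X => iSup_le fun hX => ?_
  obtain ⟨x₀, hx₀⟩ := hX.nonempty
  obtain ⟨π, _, _, hπ⟩ := hS X hX x₀ hx₀
  refine le_trans ?_ hπ
  unfold minError
  refine iInf_le_of_le S.Rand (iInf_le_of_le inferInstance (iInf_le_of_le S.randLaw ?_))
  refine iInf_le_of_le inferInstance (iInf_le_of_le 2 (iInf_le_of_le T ?_))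
  exact iInf_le_of_le two_pos (iInf_le_of_le hTN (iInf_le _ π))
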